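/- **Setting.** Let $(Z_t)_{t\in\mathbb Z}$ be i.i.d. real random variables on a probability space, with $\mathbb E Z_0=0$ and $\mathbb E Z_0^2=1$. Let $h$ be a measurable injective function on a Borel set $D\subset(0,\infty)$, with measurable inverse $\ell: h(D)\to D$ (the link function). Let the parameter space be a metric space (e.g. $\mathbb R^d$), let $\theta_0$ be one of its points, and let $\psi(z,x,\theta)$ be a real function that is Borel in $(z,x)$ for each $\theta$. Consider the volatility model $$X_t=\sigma_tZ_t,\qquad h(\sigma_{t+1}^2)=\psi(Z_t,h(\sigma_t^2),\theta_0),\qquad t\in\mathbb Z .$$ **(ST)** $(\sigma_t^2)_{t\in\mathbb Z}$ is a $D$-valued strictly stationary solution of this recursion that is non anticipative, i.e. $\sigma_t^2$ is independent of $(Z_t,Z_{t+1},\dots)$ for all $t$, with $\mathbb E\log^+\sigma_0^2<\infty$. It is unique, in the sense that every such solution, on any probability space and driven by i.i.d. innovations with the law of $Z_0$, has the same law. The inverted random maps are $\phi_t(x,\theta)=\psi\big(X_t/\sqrt{\ell(x)},x,\theta\big)$, and $\phi_0^{(r)}(\cdot,\theta)=\phi_0(\cdot,\theta)\circ\phi_{-1}(\cdot,\theta)\circ\cdots\circ\phi_{-r+1}(\cdot,\theta)$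 for $r\ge1$. Let $\Theta$ be a compact set of parameters and let $\mathcal K\subset h(D)$ be a closed subset of $\mathbb R$. Suppose that for every $t$, almost surely, $\phi_t$ maps $\mathcal K\times\Theta$ into $\mathcal K$ and $\theta\mapsto\phi_t(x,\theta)$ is continuous on $\Theta$ for every $x\in\mathcal K$. For a function $f$ on $\mathcal K\times\Theta$, $\Lambda_f$ denotes a nonnegative continuous function on $\Theta$ with $|f(x,\theta)-f(y,\theta)|\le\Lambda_f(\theta)|x-y|$ for all $x,y\in\mathcal K$ and $\theta\in\Theta$. Write $\|\cdot\|_\Theta$ for the supremum norm over $\Theta$ and $\mathcal C_\Theta$ for the space of continuous functions from $\Theta$ to $\mathcal K$. **(CI)** Random functions $\Lambda_{\phi_t}$ ($t\in\mathbb Z$) as above exist, with $\mathbb E\log^+\|\Lambda_{\phi_0}\|_\Theta<\infty$; $\mathbb E\log^+\|\phi_0(y,\cdot)\|_\Theta<\infty$ for some $y\in\mathcal K$; and for every $\theta\in\Theta$ there are $r\ge1$ and a random function $\Lambda_{\phi_0^{(r)}}$ as above with $\mathbb E\log\Lambda_{\phi_0^{(r)}}(\theta)<0$ (where $\log 0=-\infty$,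 and the value $-\infty$ of the expectation is allowed). **Theorem.** If (ST) and (CI) hold on the compact set $\Theta$, then the model is continuously invertible on $\Theta$, with an exponential rate. That is, there is a stationary process $(g_t)_{t\in\mathbb Z}$ with values in $\mathcal C_\Theta$ such that, almost surely, $$g_{t+1}(\theta)=\phi_t(g_t(\theta),\theta)\qquad\text{for all }t\in\mathbb Z,\ \theta\in\Theta ,$$ which is unique: for each $\theta\in\Theta$, every stationary $\mathcal K$-valued process $(y_t)_{t\in\mathbb Z}$ such that, for every $t\in\mathbb Z$, $y_{t+1}=\phi_t(y_t,\theta)$ a.s., satisfies $y_t=g_t(\theta)$ a.s. for all $t$. Moreover, for every (possibly random) initial function $\hat g_0$ with values in $\mathcal C_\Theta$, the approximation $\hat g_{t+1}(\theta)=\phi_t(\hat g_t(\theta),\theta)$, $t\ge0$, satisfies $\|\hat g_t-g_t\|_\Theta\to0$ a.s., and in fact $\|\hat g_t-g_t\|_\Theta\xrightarrow{e.a.s.}0$ as $t\to\infty$, i.e. $\|\hat g_t-g_t\|_\Theta=o(e^{-Ct})$ a.s. for some random variable $C>0$. -/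

import Mathlib

open MeasureTheory ProbabilityTheory Filter Topology
open scoped ENNReal NNReal

noncomputable section

namespace VolModel

/-- Spaces of continuous maps carry the Borel sigma-algebra of the compact-open topology
(the topology of uniform convergence when the source is compact). -/
instance instMeasurableSpaceContinuousMap {X Y : Type*} [TopologicalSpace X]
    [TopologicalSpace Y] : MeasurableSpace C(X, Y) := borel _

instance instBorelSpaceContinuousMap {X Y : Type*} [TopologicalSpace X]
    [TopologicalSpace Y] : BorelSpace C(X, Y) := ⟨rfl⟩

/-! ### Logarithmic moments

`log` takes values in `[-∞, ∞]` with `log 0 = -∞` and `log ∞ = ∞`. -/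

/-- The positive part of `log x`. -/
def logPlus (x : ℝ≥0∞) : ℝ≥0∞ := (ENNReal.log x).toENNReal

/-- The negative part of `log x`. -/
def logMinus (x : ℝ≥0∞) : ℝ≥0∞ := (-ENNReal.log x).toENNReal

/-- `E log L < 0`, where the expectation is the extended one, with values in `[-∞, ∞)`: the
positive part of `log L` has a finite mean, smaller than the mean (possibly `∞`) of the
negative part. -/
def MeanLogNeg {Ω : Type*} [MeasurableSpace Ω] (P : Measure Ω) (L : Ω → ℝ≥0) : Prop :=
  ∫⁻ ω, logPlus (L ω) ∂P < ∫⁻ ω, logMinus (L ω) ∂P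

/-- The uniform norm `sup_s |f s|`, with values in `[0, ∞]`. -/
def supNorm {S : Type*} (f : S → ℝ) : ℝ≥0∞ := ⨆ s, ‖f s‖ₑ

/-- Exponential almost sure convergence to zero of a sequence of nonnegative random variables:
`W t = o(exp (-C t))` almost surely for some positive random variable `C`. -/
def TendstoZeroEAS {Ω : Type*} [MeasurableSpace Ω] (P : Measure Ω) (W : ℕ → Ω → ℝ≥0∞) : Prop :=
  ∃ C : Ω → ℝ, Measurable C ∧ (∀ ω, 0 < C ω) ∧
    ∀ᵐ ω ∂P, Tendsto (fun t : ℕ => ENNReal.ofReal (Real.exp (C ω * t)) * W t ω) atTop (𝓝 0)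

/-- Strict stationarity of a process indexed by the integers: the law of the whole process is
invariant under every time shift. -/
def IsStationary {Ω S : Type*} [MeasurableSpace Ω] [MeasurableSpace S] (P : Measure Ω)
    (Y : ℤ → Ω → S) : Prop :=
  ∀ k : ℤ, IdentDistrib (fun ω (t : ℤ) => Y (t + k) ω) (fun ω (t : ℤ) => Y t ω) P P

/-- Innovations: independent identically distributed, centered, with variance one. -/
structure IsInnovation {Ω : Type*} [MeasurableSpace Ω] (P : Measure Ω) (Z : ℤ → Ω → ℝ) :
    Prop where
  measurable : ∀ t, Measurable (Z t)
  indep : iIndepFun Z P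
  ident : ∀ t, IdentDistrib (Z t) (Z 0) P P
  memLp : MemLp (Z 0) 2 P
  mean : ∫ ω, Z 0 ω ∂P = 0
  var : ∫ ω, Z 0 ω ^ 2 ∂P = 1

/-! ### The volatility model -/

/-- The data of a parametric volatility model `X_t = σ_t Z_t`,
`h (σ_{t+1}²) = ψ (Z_t, h (σ_t²), θ)`.  The function `h` is defined and injective on a set
`dom` of positive numbers, so it is a bijection of `dom` onto `h '' dom`; its inverse is the
link function `link`.  The values of `h` off `dom` and of `link` off `h '' dom` are irrelevant. -/
structure Model (E : Type*) where
  dom : Set ℝ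
  dom_pos : ∀ v ∈ dom, 0 < v
  dom_meas : MeasurableSet dom
  h : ℝ → ℝ
  h_meas : Measurable h
  link : ℝ → ℝ
  link_meas : Measurable link
  link_h : ∀ v ∈ dom, link (h v) = v
  ψ : ℝ → ℝ → E → ℝ
  ψ_meas : ∀ θ, Measurable (fun p : ℝ × ℝ => ψ p.1 p.2 θ)

section

variable {E : Type*}

/-- The map of the inverted model as a function of the observation `u`: the innovation in `ψ` is
replaced by `u / σ`, where `σ² = link x`. -/
def Model.φ (M : Model E) (u x : ℝ) (θ : E) : ℝ := M.ψ (u / √(M.link x)) x θ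

/-- `v = (σ_t²)` is a stationary non anticipative solution, with a finite log-moment, of
`h (σ_{t+1}²) = ψ (Z_t, h (σ_t²), θ₀)`. -/
structure Model.IsSolution (M : Model E) (θ₀ : E) {Ω : Type*} [MeasurableSpace Ω]
    (P : Measure Ω) (Z v : ℤ → Ω → ℝ) : Prop where
  stationary : IsStationary P v
  mem_dom : ∀ t, ∀ᵐ ω ∂P, v t ω ∈ M.dom
  sre : ∀ t, ∀ᵐ ω ∂P, M.h (v (t + 1) ω) = M.ψ (Z t ω) (M.h (v t ω)) θ₀
  nonanticipative : ∀ t, IndepFun (v t) (fun ω (n : ℕ) => Z (t + n) ω) P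
  logMoment : ∫⁻ ω, logPlus (ENNReal.ofReal (v 0 ω)) ∂P < ∞

/-- Condition (ST): `v = (σ_t²)` is such a solution, and it is the only one.  Uniqueness is
uniqueness in law: a solution driven by innovations with the same law, on any probability
space, has the law of `v`. -/
structure Model.ST (M : Model E) (θ₀ : E) {Ω : Type*} [MeasurableSpace Ω]
    (P : Measure Ω) (Z v : ℤ → Ω → ℝ) : Prop where
  solution : M.IsSolution θ₀ P Z v
  unique : ∀ (Ω' : Type) [MeasurableSpace Ω'] (P' : Measure Ω') [IsProbabilityMeasure P']
    (Z' v' : ℤ → Ω' → ℝ), IsInnovation P' Z' → IdentDistrib (Z' 0) (Z 0) P' P →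
    M.IsSolution θ₀ P' Z' v' →
    IdentDistrib (fun ω (t : ℤ) => v' t ω) (fun ω (t : ℤ) => v t ω) P' P

/-- The random maps `φ_t (x, θ)` driven by the observations `X_t = σ_t Z_t`, where
`v t = σ_t²`. -/
def Model.obsMap (M : Model E) {Ω : Type*} (Z v : ℤ → Ω → ℝ) (t : ℤ) (ω : Ω) (x : ℝ) (θ : E) :
    ℝ :=
  M.φ (√(v t ω) * Z t ω) x θ

/-- The composition `f_t ∘ f_{t-1} ∘ ⋯ ∘ f_{t-r+1}` of `r` successive maps, at fixed `θ`. -/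
def iter (f : ℤ → ℝ → E → ℝ) : ℕ → ℤ → ℝ → E → ℝ
  | 0, _ => fun x _ => x
  | r + 1, t => fun x θ => f t (iter f r (t - 1) x θ) θ

variable {Ω : Type*} [MeasurableSpace Ω]

/-- Almost surely, each random map `f_t` sends `K × Θ` to `K` and is continuous in `θ ∈ Θ`. -/
def IsRegular (P : Measure Ω) (K : Set ℝ) (Θ : Set E) [TopologicalSpace E]
    (f : ℤ → Ω → ℝ → E → ℝ) : Prop :=
  ∀ t, ∀ᵐ ω ∂P, (∀ x ∈ K, ∀ θ ∈ Θ, f t ω x θ ∈ K) ∧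
    ∀ x ∈ K, ContinuousOn (fun θ => f t ω x θ) Θ

/-- `L` is a (random) continuous function of `θ ∈ Θ` that dominates the Lipschitz coefficient of
the random map `x ↦ f (x, θ)` on `K`. -/
structure IsLipschitzBound (P : Measure Ω) (K : Set ℝ) (Θ : Set E) [TopologicalSpace E]
    (f : Ω → ℝ → E → ℝ) (L : Ω → Θ → ℝ≥0) : Prop where
  aemeasurable : ∀ θ, AEMeasurable (fun ω => L ω θ) P
  continuous : ∀ᵐ ω ∂P, Continuous (L ω)
  bound : ∀ᵐ ω ∂P, ∀ θ : Θ, ∀ x ∈ K, ∀ y ∈ K, |f ω x θ - f ω y θ| ≤ L ω θ * |x - y|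

/-- Condition (CI) on `Θ` for the random maps `f_t`: log-moments of the uniform norms, and the
Lyapunov condition at each point `θ` of `Θ` separately. -/
structure CI (P : Measure Ω) (K : Set ℝ) (Θ : Set E) [TopologicalSpace E]
    (f : ℤ → Ω → ℝ → E → ℝ) : Prop where
  moment : ∃ y ∈ K, ∫⁻ ω, logPlus (supNorm fun θ : Θ => f 0 ω y θ) ∂P < ∞
  lipMoment : ∃ L : ℤ → Ω → Θ → ℝ≥0, (∀ t, IsLipschitzBound P K Θ (f t) (L t)) ∧
    ∫⁻ ω, logPlus (supNorm fun θ : Θ => (L 0 ω θ : ℝ)) ∂P < ∞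
  lyapunov : ∀ θ : Θ, ∃ r : ℕ, 1 ≤ r ∧ ∃ L : Ω → Θ → ℝ≥0,
    IsLipschitzBound P K Θ (fun ω => iter (fun t => f t ω) r 0) L ∧
    MeanLogNeg P (fun ω => L ω θ)

/-- The approximation: `ĝ_0` is the initial function and
`ĝ_{t+1} (θ) = f_t (ĝ_t (θ), θ)` for `t ≥ 0`. -/
def approx {K : Set ℝ} {Θ : Set E} [TopologicalSpace E] (f : ℤ → Ω → ℝ → E → ℝ)
    (g₀ : Ω → C(Θ, K)) : ℕ → Ω → Θ → ℝ
  | 0 => fun ω θ => g₀ ω θ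
  | t + 1 => fun ω θ => f t ω (approx f g₀ t ω θ) θ

/-- `g` is a stationary process of continuous functions from `Θ` to `K` such that
`g_{t+1} (θ) = f_t (g_t (θ), θ)` for all integers `t` and all `θ ∈ Θ`. -/
structure IsStationarySolution (P : Measure Ω) {K : Set ℝ} {Θ : Set E} [TopologicalSpace E]
    (f : ℤ → Ω → ℝ → E → ℝ) (g : ℤ → Ω → C(Θ, K)) : Prop where
  stationary : IsStationary P g
  sre : ∀ᵐ ω ∂P, ∀ (t : ℤ) (θ : Θ), (g (t + 1) ω θ : ℝ) = f t ω (g t ω θ) θ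

/-- The values `g_t (θ)` are determined by the recursion at `θ`: at each `θ ∈ Θ`, every
stationary `K`-valued process `y` with `y_{t+1} = f_t (y_t, θ)` coincides with `g_t (θ)`. -/
def IsUniqueAtEachPoint (P : Measure Ω) {K : Set ℝ} {Θ : Set E} [TopologicalSpace E]
    (f : ℤ → Ω → ℝ → E → ℝ) (g : ℤ → Ω → C(Θ, K)) : Prop :=
  ∀ (θ : Θ) (y : ℤ → Ω → ℝ), IsStationary P y → (∀ t, ∀ᵐ ω ∂P, y t ω ∈ K) →
    (∀ t, ∀ᵐ ω ∂P, y (t + 1) ω = f t ω (y t ω) θ) → ∀ t, ∀ᵐ ω ∂P, y t ω = g t ω θ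

/-- The uniform distance `‖ĝ_t - g_t‖` on `Θ`. -/
def approxError {K : Set ℝ} {Θ : Set E} [TopologicalSpace E] (f : ℤ → Ω → ℝ → E → ℝ)
    (g : ℤ → Ω → C(Θ, K)) (g₀ : Ω → C(Θ, K)) (t : ℕ) (ω : Ω) : ℝ≥0∞ :=
  supNorm fun θ : Θ => approx f g₀ t ω θ - g t ω θ

/-- Continuous invertibility on `Θ`: whatever the initial function, `‖ĝ_t - g_t‖` tends to `0`
almost surely, where `g` is the stationary solution. -/
def ContinuouslyInvertible (P : Measure Ω) {K : Set ℝ} {Θ : Set E} [TopologicalSpace E]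
    (f : ℤ → Ω → ℝ → E → ℝ) (g : ℤ → Ω → C(Θ, K)) : Prop :=
  ∀ g₀ : Ω → C(Θ, K), ∀ᵐ ω ∂P, Tendsto (fun t : ℕ => approxError f g g₀ t ω) atTop (𝓝 0)

end

end VolModel

end

/-! Everything is read off the path of the pairs `(σ_t², Z_t)` and its law `Q`.

Ergodicity comes from uniqueness. An event pushed into the remote past becomes, jointly with `σ_t²`,
asymptotically independent of the innovations from time `t` on; a shift invariant event `I` does not
move, so it is exactly so (`Model.IsSolutionLaw.measure_inter_of_invariant`). Hence, if `Q I > 0`,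
conditioning on `I` gives another solution with innovations of the same law
(`Model.IsSolutionLaw.cond`). By uniqueness `σ_0²` has the same law under both measures. Since the
laws of `σ_0²` and `Z_0` determine the path law, `Q[|I] = Q` and `Q I = 1`.

The Lyapunov condition is local in `θ` but open: by continuity of the Lipschitz bound and the two
Fatou lemmas it survives taking the supremum over a small ball (`exists_ball_lyapunov`). The ergodic
theorem, of which only an upper bound is needed, then makes long compositions contract
exponentially, uniformly over that ball, both backwards from any time and forwards from time `0`
(`ae_isContracting_ball`). Finitely many balls cover `Θ` (`exists_ae_isContracting`).

With uniform contraction the rest is a fixed point argument. Backward iterates started at `y` are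
uniformly Cauchy, because `φ_t(y, ·)` grows subexponentially along the path; their limit `g` is a
shift equivariant function of the path, hence stationary, and solves the recursion. Two stationary
solutions at the same `θ` are bounded along a common sequence of past times, so contraction from
there identifies them. The approximation and `g` are images of two initial functions under the same
forward compositions, which gives the exponential rate. -/

namespace VolModel

/-! ### Upper bounds for Birkhoff sums -/

section Birkhoff

variable {α : Type*}

/-- The maximal function `max (0, S₁ F, …, Sₙ F)` of the Birkhoff sums of `F` along `T`. -/
def birkhoffMax (T : α → α) (F : α → ℝ) : ℕ → α → ℝ
  | 0 => fun _ => 0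
  | n + 1 => fun w => max 0 (F w + birkhoffMax T F n (T w))

lemma birkhoffMax_nonneg (T : α → α) (F : α → ℝ) (n : ℕ) (w : α) : 0 ≤ birkhoffMax T F n w := by
  cases n with
  | zero => exact le_rfl
  | succ n => exact le_max_left _ _

lemma birkhoffMax_le_succ (T : α → α) (F : α → ℝ) (n : ℕ) (w : α) :
    birkhoffMax T F n w ≤ birkhoffMax T F (n + 1) w := by
  induction n generalizing w with
  | zero => exact birkhoffMax_nonneg T F 1 w
  | succ n ih => exact max_le_max le_rfl (add_le_add le_rfl (ih (T w)))

lemma birkhoffSum_le_birkhoffMax (T : α → α) (F : α → ℝ) (n : ℕ) (w : α) :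
    birkhoffSum T F n w ≤ birkhoffMax T F n w := by
  induction n generalizing w with
  | zero => simp [birkhoffMax]
  | succ n ih =>
    rw [birkhoffSum_succ']
    exact (add_le_add le_rfl (ih (T w))).trans (le_max_right _ _)

variable [MeasurableSpace α]

lemma measurable_birkhoffMax {T : α → α} {F : α → ℝ} (hT : Measurable T) (hF : Measurable F)
    (n : ℕ) : Measurable (birkhoffMax T F n) := by
  induction n with
  | zero => exact measurable_const
  | succ n ih => exact measurable_const.max (hF.add (ih.comp hT))

variable {μ : Measure α}

lemma integrable_birkhoffMax {T : α → α} {F : α → ℝ} (hT : MeasurePreserving T μ μ)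
    (hF : Integrable F μ) (n : ℕ) : Integrable (birkhoffMax T F n) μ := by
  induction n with
  | zero => exact integrable_zero _ _ _
  | succ n ih => exact (integrable_zero _ _ _).sup (hF.add (hT.integrable_comp_of_integrable ih))

/-- The maximal ergodic inequality. -/
lemma setIntegral_birkhoffMax_pos_nonneg {T : α → α} {F : α → ℝ} (hT : MeasurePreserving T μ μ)
    (hFm : Measurable F) (hF : Integrable F μ) (n : ℕ) :
    0 ≤ ∫ w in {w | 0 < birkhoffMax T F n w}, F w ∂μ := by
  cases n with
  | zero => simp [birkhoffMax]
  | succ n =>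
    have hms : MeasurableSet {w | 0 < birkhoffMax T F (n + 1) w} :=
      measurableSet_lt measurable_const (measurable_birkhoffMax hT.measurable hFm _)
    have hM := integrable_birkhoffMax hT hF (n + 1)
    have hMT : Integrable (fun w => birkhoffMax T F (n + 1) (T w)) μ :=
      hT.integrable_comp_of_integrable hM
    -- Garsia's argument: with `M` the maximal function, `M - M ∘ T` has mean zero, is at most `F`
    -- where `M > 0`, and is nonpositive where `M = 0`.
    have h0 : ∫ w, (birkhoffMax T F (n + 1) w - birkhoffMax T F (n + 1) (T w)) ∂μ = 0 := by
      rw [integral_sub hM hMT]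
      have := integral_map hT.measurable.aemeasurable
        (f := birkhoffMax T F (n + 1)) (by rw [hT.map_eq]; exact hM.aestronglyMeasurable)
      rw [hT.map_eq] at this
      rw [← this, sub_self]
    rw [← integral_indicator hms]
    refine h0.ge.trans ?_
    refine integral_mono (hM.sub hMT) (hF.indicator hms) fun w => ?_
    by_cases hw : 0 < birkhoffMax T F (n + 1) w
    · rw [Set.indicator_of_mem (by exact hw)]
      have h1 : birkhoffMax T F (n + 1) w = F w + birkhoffMax T F n (T w) := by
        change max 0 _ = _
        change 0 < max 0 _ at hw
        exact max_eq_right ((lt_max_iff.1 hw).resolve_left (lt_irrefl _)).le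
      have h2 := birkhoffMax_le_succ T F n (T w)
      simp only
      linarith
    · rw [Set.indicator_of_notMem (by exact hw)]
      have := birkhoffMax_nonneg T F (n + 1) (T w)
      simp only
      linarith

omit [MeasurableSpace α] in
-- Makes the set of points with bounded maximal functions exactly invariant, so that ergodicity
-- applies to it.
lemma exists_birkhoffMax_le_comp_iff (T : α → α) (F : α → ℝ) (w : α) :
    (∃ C : ℕ, ∀ n, birkhoffMax T F n (T w) ≤ C) ↔ ∃ C : ℕ, ∀ n, birkhoffMax T F n w ≤ C := by
  constructor
  · rintro ⟨C, hC⟩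
    obtain ⟨N, hN⟩ := exists_nat_ge (max 0 (F w + C))
    refine ⟨N, fun n => ?_⟩
    refine (birkhoffMax_le_succ T F n w).trans (le_trans ?_ hN)
    exact max_le_max le_rfl (add_le_add le_rfl (hC n))
  · rintro ⟨C, hC⟩
    obtain ⟨N, hN⟩ := exists_nat_ge (C - F w)
    refine ⟨N, fun n => ?_⟩
    have h := (le_max_right _ _).trans (hC (n + 1))
    linarith

lemma ae_exists_birkhoffSum_le_of_integral_neg [IsProbabilityMeasure μ] {T : α → α} {F : α → ℝ}
    (hT : Ergodic T μ) (hFm : Measurable F) (hF : Integrable F μ) (hneg : ∫ w, F w ∂μ < 0) :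
    ∀ᵐ w ∂μ, ∃ C : ℝ, ∀ n, birkhoffSum T F n w ≤ C := by
  set B : Set α := {w | ∃ C : ℕ, ∀ n, birkhoffMax T F n w ≤ C} with hB
  have hBm : MeasurableSet B := by
    have : B = ⋃ C : ℕ, ⋂ n, {w | birkhoffMax T F n w ≤ C} := by ext; simp [hB]
    rw [this]
    exact .iUnion fun C => .iInter fun n =>
      measurableSet_le (measurable_birkhoffMax hT.measurable hFm n) measurable_const
  have hinv : T ⁻¹' B = B := by
    ext w
    exact exists_birkhoffMax_le_comp_iff T F w
  have hfull : ∀ᵐ w ∂μ, w ∈ B := by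
    rcases hT.ae_mem_or_ae_notMem hBm hinv with h | h
    · exact h
    · exfalso
      -- If the bounded set were null, almost every point would have a positive maximum for some
      -- `n`; the maximal inequality would pass to the limit and give `0 ≤ ∫ F`.
      have hmono : Monotone fun n => {w | 0 < birkhoffMax T F n w} :=
        monotone_nat_of_le_succ fun n w hw => lt_of_lt_of_le hw (birkhoffMax_le_succ T F n w)
      have hlim := tendsto_setIntegral_of_monotone (μ := μ) (f := F)
        (fun n => measurableSet_lt measurable_const (measurable_birkhoffMax hT.measurable hFm n))
        hmono hF.integrableOn
      have huniv : (⋃ n, {w | 0 < birkhoffMax T F n w}) =ᵐ[μ] Set.univ := by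
        rw [ae_eq_univ, ← nonpos_iff_eq_zero]
        refine (measure_mono ?_).trans (ae_iff.1 h).le
        intro w hw
        simp only [Set.mem_compl_iff, Set.mem_iUnion, not_exists, Set.mem_ofPred_eq, not_lt] at hw
        simp only [Set.mem_ofPred_eq, not_not]
        exact ⟨0, fun n => by simpa using hw n⟩
      rw [setIntegral_congr_set huniv, setIntegral_univ] at hlim
      exact absurd (ge_of_tendsto' hlim fun n =>
        setIntegral_birkhoffMax_pos_nonneg hT.toMeasurePreserving hFm hF n) (not_le.2 hneg)
  filter_upwards [hfull] with w ⟨C, hC⟩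
  exact ⟨C, fun n => (birkhoffSum_le_birkhoffMax T F n w).trans (hC n)⟩

/-- The upper half of the pointwise ergodic theorem. -/
theorem ae_exists_birkhoffSum_le [IsProbabilityMeasure μ] {T : α → α} {F : α → ℝ}
    (hT : Ergodic T μ) (hFm : Measurable F) (hF : Integrable F μ) {c : ℝ}
    (hc : ∫ w, F w ∂μ < c) :
    ∀ᵐ w ∂μ, ∃ C : ℝ, ∀ n : ℕ, ∑ i ∈ Finset.range n, F (T^[i] w) ≤ C + c * n := by
  have := ae_exists_birkhoffSum_le_of_integral_neg hT (hFm.sub_const c)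
    (hF.sub (integrable_const c)) (by
      rw [integral_sub hF (integrable_const c)]; simpa using hc)
  filter_upwards [this] with w ⟨C, hC⟩
  refine ⟨C, fun n => ?_⟩
  have := hC n
  simp only [birkhoffSum, Finset.sum_sub_distrib, Finset.sum_const, Finset.card_range,
    nsmul_eq_mul] at this
  linarith [mul_comm c n]

/-- Along almost every orbit of an ergodic map an integrable function grows sublinearly. -/
theorem ae_exists_comp_iterate_le [IsProbabilityMeasure μ] {T : α → α} {F : α → ℝ}
    (hT : Ergodic T μ) (hFm : Measurable F) (hF : Integrable F μ) {ε : ℝ} (hε : 0 < ε) :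
    ∀ᵐ w ∂μ, ∃ C : ℝ, ∀ n : ℕ, F (T^[n] w) ≤ C + ε * n := by
  -- `F ∘ T^n` is a difference of consecutive Birkhoff sums: bound one from above through `F` and
  -- the other from below through `-F`, each with a slope error `ε / 2`.
  have h1 := ae_exists_birkhoffSum_le hT hFm hF (c := ∫ w, F w ∂μ + ε / 2) (by linarith)
  have h2 := ae_exists_birkhoffSum_le hT hFm.neg hF.neg (c := -∫ w, F w ∂μ + ε / 2)
    (by simp only [Pi.neg_apply, integral_neg]; linarith)
  filter_upwards [h1, h2] with w ⟨C, hC⟩ ⟨D, hD⟩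
  refine ⟨C + D + ∫ w, F w ∂μ + ε / 2, fun n => ?_⟩
  have e1 := hC (n + 1)
  have e2 := hD n
  simp only [Finset.sum_range_succ, Pi.neg_apply, Finset.sum_neg_distrib] at e1 e2
  push_cast at e1
  linarith

end Birkhoff

/-! ### The path space -/

/-- The time shift by `k` on two-sided sequences. -/
def shift {S : Type*} (k : ℤ) (w : ℤ → S) : ℤ → S := fun t => w (t + k)

/-- The sequence of the values of `w` from time `t` on. -/
def future {S : Type*} (t : ℤ) (w : ℤ → S) : ℕ → S := fun n => w (t + n)

@[simp] lemma shift_apply {S : Type*} (k : ℤ) (w : ℤ → S) (t : ℤ) : shift k w t = w (t + k) := rfl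

@[simp] lemma future_apply {S : Type*} (t : ℤ) (w : ℤ → S) (n : ℕ) :
    future t w n = w (t + n) := rfl

@[fun_prop]
lemma measurable_shift {S : Type*} [MeasurableSpace S] (k : ℤ) :
    Measurable (shift k : (ℤ → S) → ℤ → S) :=
  measurable_pi_lambda _ fun t => measurable_pi_apply (t + k)

@[fun_prop]
lemma measurable_future {S : Type*} [MeasurableSpace S] (t : ℤ) :
    Measurable (future t : (ℤ → S) → ℕ → S) :=
  measurable_pi_lambda _ fun n => measurable_pi_apply (t + n)

lemma shift_shift {S : Type*} (k l : ℤ) (w : ℤ → S) : shift k (shift l w) = shift (k + l) w := by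
  ext t; simp [add_assoc]

lemma shift_iterate {S : Type*} (k : ℤ) (n : ℕ) (w : ℤ → S) :
    (shift k)^[n] w = shift (n * k) w := by
  induction n with
  | zero => ext; simp
  | succ n ih =>
    rw [Function.iterate_succ_apply', ih, shift_shift]; congr 1; push_cast; ring

/-- A finite measure on two-sided sequences is determined by the laws of the futures. -/
lemma measure_ext_of_map_future {S : Type*} [MeasurableSpace S] {μ ν : Measure (ℤ → S)}
    [IsFiniteMeasure μ] (h : ∀ t, μ.map (future t) = ν.map (future t)) : μ = ν := by
  have key : IsProjectiveLimit ν fun I : Finset ℤ => μ.map I.restrict := by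
    intro I
    obtain ⟨s, hs⟩ : ∃ s : ℤ, ∀ i ∈ I, s ≤ i := by
      obtain ⟨s, hs⟩ := I.bddBelow
      exact ⟨s, fun i hi => hs hi⟩
    have hm : Measurable fun (x : ℕ → S) (i : I) => x ((i : ℤ) - s).toNat :=
      measurable_pi_lambda _ fun i => measurable_pi_apply _
    have hc : (I.restrict : (ℤ → S) → I → S) =
        (fun (x : ℕ → S) (i : I) => x ((i : ℤ) - s).toNat) ∘ future s := by
      ext w i
      have : s + (((i : ℤ) - s).toNat : ℤ) = i := by
        rw [Int.toNat_of_nonneg (sub_nonneg.2 (hs i i.2))]; ring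
      change w i = w (s + (((i : ℤ) - s).toNat : ℤ))
      rw [this]
    change _ = μ.map I.restrict
    rw [hc, ← Measure.map_map hm (measurable_future s), ← Measure.map_map hm (measurable_future s),
      h s]
  exact IsProjectiveLimit.unique (fun I => rfl) key

/-! ### Independence of the past and the future of the innovations -/

/-- The hypotheses make the joint law of the triple a product of three laws, and products
reassociate. -/
lemma indepFun_prodMk_of_indepFun {Ω α β γ : Type*} [MeasurableSpace Ω] [MeasurableSpace α]
    [MeasurableSpace β] [MeasurableSpace γ] {P : Measure Ω} [IsProbabilityMeasure P]
    {X : Ω → α} {Y : Ω → β} {Z : Ω → γ} (hX : AEMeasurable X P) (hY : AEMeasurable Y P)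
    (hZ : AEMeasurable Z P) (h : IndepFun X (fun ω => (Y ω, Z ω)) P) (hYZ : IndepFun Y Z P) :
    IndepFun (fun ω => (X ω, Y ω)) Z P := by
  have hXY : IndepFun X Y P := h.comp measurable_id measurable_fst
  rw [indepFun_iff_map_prod_eq_prod_map_map (by fun_prop) (by fun_prop)] at h hYZ hXY ⊢
  apply MeasurableEquiv.prodAssoc.map_measurableEquiv_injective
  have : IsProbabilityMeasure (P.map X) := Measure.isProbabilityMeasure_map hX
  have : IsProbabilityMeasure (P.map Y) := Measure.isProbabilityMeasure_map hY
  have : IsProbabilityMeasure (P.map Z) := Measure.isProbabilityMeasure_map hZ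
  rw [hXY, Measure.prodAssoc_prod, ← hYZ, ← h,
    AEMeasurable.map_map_of_aemeasurable MeasurableEquiv.prodAssoc.measurable.aemeasurable
      (by fun_prop)]
  rfl

/-- The first `k` terms of a sequence, followed by zeros. -/
def trunc {S : Type*} [Zero S] (k : ℕ) (z : ℕ → S) : ℕ → S := fun n => if n < k then z n else 0

lemma measurable_trunc {S : Type*} [Zero S] [MeasurableSpace S] (k : ℕ) :
    Measurable (trunc k : (ℕ → S) → ℕ → S) := by
  refine measurable_pi_lambda _ fun n => ?_
  by_cases h : n < k
  · simpa [trunc, h] using measurable_pi_apply n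
  · simp [trunc, h]

/-- The two sides use disjoint sets of times. Padding with zeros keeps the finite block in `ℕ → ℝ`,
where `Model.volatility` can read it. -/
lemma iIndepFun.indepFun_trunc_future {Ω : Type*} [MeasurableSpace Ω] {P : Measure Ω}
    {Z : ℤ → Ω → ℝ} (hm : ∀ t, Measurable (Z t)) (hZ : iIndepFun Z P) (s : ℤ) (k : ℕ) :
    IndepFun (fun ω => trunc k fun n => Z (s + n) ω) (fun ω (n : ℕ) => Z (s + k + n) ω) P := by
  have hle : ∀ t, MeasurableSpace.comap (Z t) inferInstance ≤ (inferInstance : MeasurableSpace Ω) :=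
    fun t => (hm t).comap_le
  have h := indep_iSup_of_disjoint hle hZ (S := Set.Iio (s + k)) (T := Set.Ici (s + k))
    (Set.disjoint_left.2 fun x (hx : x < s + k) (hx' : s + k ≤ x) => not_le.2 hx hx')
  refine indep_of_indep_of_le_left (indep_of_indep_of_le_right h ?_) ?_
  · rw [← measurable_iff_comap_le]
    refine @measurable_pi_lambda _ _ _ (_) _ _ fun n => ?_
    refine Measurable.mono (comap_measurable (Z (s + k + n))) ?_ le_rfl
    exact le_iSup₂_of_le (s + k + (n : ℤ)) (by simp) le_rfl
  · rw [← measurable_iff_comap_le]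
    refine @measurable_pi_lambda _ _ _ (_) _ _ fun n => ?_
    by_cases hn : n < k
    · simp only [trunc, hn, if_true]
      refine Measurable.mono (comap_measurable (Z (s + n))) ?_ le_rfl
      exact le_iSup₂_of_le (s + (n : ℤ)) (by simpa using hn) le_rfl
    · simp only [trunc, hn, if_false]
      exact @measurable_const _ _ _ (_) _

/-! ### Solutions of the volatility recursion on the path space -/

section Ergodicity

variable {E : Type*} (M : Model E) (θ₀ : E)

/-- The squared volatility at time `n`, from its initial value and the innovations. -/
def Model.volatility : ℕ → ℝ × (ℕ → ℝ) → ℝ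
  | 0 => fun p => p.1
  | n + 1 => fun p => M.link (M.ψ (p.2 n) (M.h (Model.volatility n p)) θ₀)

/-- Squared volatilities and innovations, from the initial volatility and the innovations. -/
def Model.simulate (p : ℝ × (ℕ → ℝ)) : ℕ → ℝ × ℝ := fun n => (M.volatility θ₀ n p, p.2 n)

lemma Model.measurable_volatility (n : ℕ) : Measurable (M.volatility θ₀ n) := by
  induction n with
  | zero => exact measurable_fst
  | succ n ih =>
    exact M.link_meas.comp ((M.ψ_meas θ₀).comp
      (((measurable_pi_apply n).comp measurable_snd).prodMk (M.h_meas.comp ih)))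

lemma Model.measurable_simulate : Measurable (M.simulate θ₀) :=
  measurable_pi_lambda _ fun n =>
    (M.measurable_volatility θ₀ n).prodMk ((measurable_pi_apply n).comp measurable_snd)

lemma Model.volatility_trunc {k n : ℕ} (hn : n ≤ k) (x : ℝ) (z : ℕ → ℝ) :
    M.volatility θ₀ n (x, trunc k z) = M.volatility θ₀ n (x, z) := by
  induction n with
  | zero => rfl
  | succ n ih =>
    simp only [Model.volatility, ih (by omega)]
    simp [trunc, show n < k by omega]

variable {M θ₀}

/-- Measurability of `v` is contained in the identity of laws that expresses stationarity. -/
lemma Model.IsSolution.aemeasurable {Ω : Type*} [MeasurableSpace Ω] {P : Measure Ω}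
    {Z v : ℤ → Ω → ℝ} (h : M.IsSolution θ₀ P Z v) (t : ℤ) : AEMeasurable (v t) P :=
  aemeasurable_pi_iff.1 (by simpa using (h.stationary 0).aemeasurable_fst) t

/-- On `dom`, where the solution lives, `link` inverts `h`, so the recursion can be solved forwards
from any time `s`. -/
lemma Model.IsSolution.ae_eq_volatility {Ω : Type*} [MeasurableSpace Ω] {P : Measure Ω}
    {Z v : ℤ → Ω → ℝ} (h : M.IsSolution θ₀ P Z v) (s : ℤ) :
    ∀ᵐ ω ∂P, ∀ n : ℕ, v (s + n) ω = M.volatility θ₀ n (v s ω, fun n => Z (s + n) ω) := by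
  filter_upwards [ae_all_iff.2 h.mem_dom, ae_all_iff.2 h.sre] with ω hd hs n
  induction n with
  | zero => simp [Model.volatility]
  | succ n ih =>
    have : s + ((n + 1 : ℕ) : ℤ) = s + n + 1 := by push_cast; ring
    rw [this, ← M.link_h _ (hd _), hs, ih]
    rfl

/-- The path law of a solution. -/
structure Model.IsSolutionLaw (M : Model E) (θ₀ : E) (Q : Measure (ℤ → ℝ × ℝ)) : Prop where
  innovation : IsInnovation Q fun t w => (w t).2
  solution : M.IsSolution θ₀ Q (fun t w => (w t).2) fun t w => (w t).1

lemma measurable_path_fst (t : ℤ) : Measurable fun w : ℤ → ℝ × ℝ => (w t).1 :=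
  measurable_fst.comp (measurable_pi_apply t)

lemma measurable_path_snd (t : ℤ) : Measurable fun w : ℤ → ℝ × ℝ => (w t).2 :=
  measurable_snd.comp (measurable_pi_apply t)

lemma IsInnovation.map_seq {Ω : Type*} [MeasurableSpace Ω] {P : Measure Ω}
    {Z : ℤ → Ω → ℝ} (h : IsInnovation P Z) (s : ℤ) :
    P.map (fun ω (n : ℕ) => Z (s + n) ω) = Measure.infinitePi fun _ => P.map (Z 0) := by
  have h' := h.indep.precomp (g := fun n : ℕ => s + (n : ℤ)) fun a b hab => by simpa using hab
  rw [iIndepFun.map_fun_eq_infinitePi_map (fun i => h.measurable _) h']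
  congr 1
  ext1 n
  exact (h.ident _).map_eq

/-- Law of the future of a solution, in terms of the marginal laws. -/
lemma Model.IsSolutionLaw.map_future {Q : Measure (ℤ → ℝ × ℝ)} [IsProbabilityMeasure Q]
    (h : M.IsSolutionLaw θ₀ Q) (s : ℤ) :
    Q.map (future s) = ((Q.map fun w => (w 0).1).prod
      (Measure.infinitePi fun _ => Q.map fun w => (w 0).2)).map (M.simulate θ₀) := by
  have hs : Q.map (fun w => (w s).1) = Q.map fun w => (w 0).1 := by
    have := ((h.solution.stationary s).comp (measurable_pi_apply 0)).map_eq
    simpa [Function.comp_def] using this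
  have hm : Measurable fun (w : ℤ → ℝ × ℝ) (n : ℕ) => (w (s + n)).2 :=
    measurable_pi_lambda _ fun n => measurable_path_snd _
  rw [← hs, ← h.innovation.map_seq s, ← (indepFun_iff_map_prod_eq_prod_map_map
    (measurable_path_fst s).aemeasurable hm.aemeasurable).1 (h.solution.nonanticipative s),
    Measure.map_map (M.measurable_simulate θ₀) ((measurable_path_fst s).prodMk hm)]
  refine Measure.map_congr ?_
  filter_upwards [h.solution.ae_eq_volatility s] with w hw
  ext n
  · exact hw n
  · rfl

lemma Model.IsSolutionLaw.ext {Q Q' : Measure (ℤ → ℝ × ℝ)} [IsProbabilityMeasure Q]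
    [IsProbabilityMeasure Q'] (h : M.IsSolutionLaw θ₀ Q) (h' : M.IsSolutionLaw θ₀ Q')
    (hv : Q.map (fun w => (w 0).1) = Q'.map fun w => (w 0).1)
    (hz : Q.map (fun w => (w 0).2) = Q'.map fun w => (w 0).2) : Q = Q' :=
  measure_ext_of_map_future fun s => by rw [h.map_future, h'.map_future, hv, hz]

/-- Joint stationarity of volatilities and innovations, whereas (ST) gives it for the volatilities
only: the law of the future found in `map_future` does not depend on its starting time. -/
lemma Model.IsSolutionLaw.measurePreserving_shift {Q : Measure (ℤ → ℝ × ℝ)}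
    [IsProbabilityMeasure Q] (h : M.IsSolutionLaw θ₀ Q) (k : ℤ) :
    MeasurePreserving (shift k) Q Q := by
  refine ⟨measurable_shift k, ?_⟩
  have : IsProbabilityMeasure (Q.map (shift k)) :=
    Measure.isProbabilityMeasure_map (measurable_shift k).aemeasurable
  refine measure_ext_of_map_future fun s => ?_
  rw [Measure.map_map (measurable_future s) (measurable_shift k)]
  have : future s ∘ shift k = (future (s + k) : (ℤ → ℝ × ℝ) → _) := by
    ext w n <;> simp [add_right_comm]
  rw [this, h.map_future, h.map_future]

/-- Finitely many pairs before time `t` and the volatility at time `t` are independent of the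
innovations from time `t` on. -/
lemma Model.IsSolutionLaw.indepFun_past {Q : Measure (ℤ → ℝ × ℝ)} [IsProbabilityMeasure Q]
    (h : M.IsSolutionLaw θ₀ Q) (I : Finset ℤ) (t : ℤ) (hI : ∀ i ∈ I, i < t) :
    IndepFun (fun w => (I.restrict w, (w t).1)) (fun w (n : ℕ) => (w (t + n)).2) Q := by
  obtain ⟨k, hk⟩ : ∃ k : ℕ, ∀ i ∈ I, t - k ≤ i := by
    obtain ⟨b, hb⟩ := I.bddBelow
    refine ⟨(t - b).toNat, fun i hi => ?_⟩
    have := hb hi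
    have := Int.self_le_toNat (t - b)
    linarith
  -- Start at a time `s` before all of `I`: everything on the left is then a function `G` of `σ_s²`
  -- and the `k` innovations between `s` and `t`.
  obtain ⟨s, rfl⟩ : ∃ s, t = s + (k : ℤ) := ⟨t - k, by ring⟩
  simp only [add_sub_cancel_right] at hk
  have hms : Measurable fun (w : ℤ → ℝ × ℝ) (n : ℕ) => (w (s + n)).2 :=
    measurable_pi_lambda _ fun n => measurable_path_snd _
  have hmt : Measurable fun (w : ℤ → ℝ × ℝ) (n : ℕ) => (w (s + k + n)).2 :=
    measurable_pi_lambda _ fun n => measurable_path_snd _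
  have h1 := iIndepFun.indepFun_trunc_future h.innovation.measurable h.innovation.indep s k
  have h2 : IndepFun (fun w : ℤ → ℝ × ℝ => (w s).1)
      (fun w => (trunc k fun n => (w (s + n)).2, fun n : ℕ => (w (s + k + n)).2)) Q := by
    have hφ : Measurable fun z : ℕ → ℝ => (trunc k z, fun n : ℕ => z (k + n)) :=
      (measurable_trunc k).prodMk (measurable_pi_lambda _ fun n => measurable_pi_apply (k + n))
    have := (h.solution.nonanticipative s).comp measurable_id hφ
    simpa [Function.comp_def, add_assoc] using this
  have h3 := indepFun_prodMk_of_indepFun (measurable_path_fst s).aemeasurable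
    ((measurable_trunc k).comp hms).aemeasurable hmt.aemeasurable h2 h1
  let G : ℝ × (ℕ → ℝ) → (I → ℝ × ℝ) × ℝ := fun p =>
    (fun i => M.simulate θ₀ p ((i : ℤ) - s).toNat, M.volatility θ₀ k p)
  have hG : Measurable G :=
    (measurable_pi_lambda _ fun i => (measurable_pi_apply _).comp (M.measurable_simulate θ₀)).prodMk
      (M.measurable_volatility θ₀ k)
  refine (h3.comp hG measurable_id).congr ?_ (ae_eq_refl _)
  filter_upwards [h.solution.ae_eq_volatility s] with w hw
  refine Prod.ext ?_ ?_
  · ext1 i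
    have hi := hk i i.2
    have hi' := hI i i.2
    have e : s + (((i : ℤ) - s).toNat : ℤ) = i := by
      rw [Int.toNat_of_nonneg (sub_nonneg.2 hi)]; ring
    have hlt : ((i : ℤ) - s).toNat < k := by omega
    have hv := hw ((i : ℤ) - s).toNat
    rw [e] at hv
    refine Prod.ext ?_ ?_
    · simp only [Function.comp_apply, G, Model.simulate, Finset.restrict]
      rw [M.volatility_trunc θ₀ hlt.le, hv]
    · simp only [Function.comp_apply, G, Model.simulate, Finset.restrict, trunc, hlt, if_true, e]
  · simp only [Function.comp_apply, G]
    rw [M.volatility_trunc θ₀ le_rfl, hw k]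

/-- A shift invariant event, joined with the volatility at time `t`, is independent of the
innovations from time `t` on. -/
lemma Model.IsSolutionLaw.measure_inter_of_invariant {Q : Measure (ℤ → ℝ × ℝ)}
    [IsProbabilityMeasure Q] (h : M.IsSolutionLaw θ₀ Q) {I : Set (ℤ → ℝ × ℝ)}
    (hI : MeasurableSet I) (hinv : ∀ k, shift k ⁻¹' I = I) (t : ℤ) {A : Set ℝ}
    (hA : MeasurableSet A) {B : Set (ℕ → ℝ)} (hB : MeasurableSet B) :
    Q (I ∩ ((fun w => (w t).1) ⁻¹' A ∩ (fun w (n : ℕ) => (w (t + n)).2) ⁻¹' B)) =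
      Q (I ∩ (fun w => (w t).1) ⁻¹' A) * Q ((fun w (n : ℕ) => (w (t + n)).2) ⁻¹' B) := by
  set a : Set (ℤ → ℝ × ℝ) := (fun w => (w t).1) ⁻¹' A with ha
  set b : Set (ℤ → ℝ × ℝ) := (fun w (n : ℕ) => (w (t + n)).2) ⁻¹' B with hb
  have hma : MeasurableSet a := measurable_path_fst t hA
  have hmb : MeasurableSet b := (measurable_pi_lambda _ fun n => measurable_path_snd _) hB
  -- The defect of independence for `J` moved `n` steps into the past. It tends to zero for all
  -- measurable `J` by a Dynkin argument: on cylinders it vanishes as soon as all coordinates lie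
  -- before `t`, and countable disjoint unions are dominated by `Q (J i)`. For the invariant `I` it
  -- is constant in `n`, hence zero.
  let D : Set (ℤ → ℝ × ℝ) → ℕ → ℝ := fun J n =>
    Q.real (shift (-n) ⁻¹' J ∩ (a ∩ b)) - Q.real (shift (-n) ⁻¹' J ∩ a) * Q.real b
  have hm : ∀ {J : Set (ℤ → ℝ × ℝ)} (n : ℕ), MeasurableSet J →
      MeasurableSet (shift (-(n : ℤ)) ⁻¹' J) := fun n hJ => measurable_shift _ hJ
  have hQ : ∀ {J : Set (ℤ → ℝ × ℝ)} (n : ℕ), MeasurableSet J →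
      Q.real (shift (-(n : ℤ)) ⁻¹' J) = Q.real J := fun n hJ =>
    (h.measurePreserving_shift _).measureReal_preimage hJ.nullMeasurableSet
  have hab : Q.real (a ∩ b) = Q.real a * Q.real b := by
    have := indepFun_iff_measure_inter_preimage_eq_mul.1 (h.solution.nonanticipative t) A B hA hB
    rw [measureReal_def, this, ENNReal.toReal_mul]
    rfl
  have htend : ∀ J, MeasurableSet J → Tendsto (D J) atTop (𝓝 0) := by
    refine MeasurableSpace.induction_on_inter generateFrom_measurableCylinders.symm
      isPiSystem_measurableCylinders ?_ ?_ ?_ ?_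
    · simp [D]
    · intro J hJ
      obtain ⟨F, S, hS, rfl⟩ := (mem_measurableCylinders _).1 hJ
      obtain ⟨u, hu⟩ := F.bddAbove
      refine tendsto_const_nhds.congr' ?_
      filter_upwards [eventually_gt_atTop (u - t).toNat] with n hn
      let F' : Finset ℤ := F.image fun i => i - (n : ℤ)
      have hF' : ∀ i ∈ F', i < t := by
        intro i hi
        obtain ⟨j, hj, rfl⟩ := Finset.mem_image.1 hi
        have := hu hj
        omega
      let r : (F' → ℝ × ℝ) → F → ℝ × ℝ := fun x i =>
        x ⟨i - n, Finset.mem_image.2 ⟨i, i.2, rfl⟩⟩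
      have hr : Measurable r := measurable_pi_lambda _ fun i => measurable_pi_apply _
      have hind := indepFun_iff_measure_inter_preimage_eq_mul.1 (h.indepFun_past F' t hF')
        ((r ⁻¹' S) ×ˢ A) B ((hr hS).prod hA) hB
      have e : (fun w : ℤ → ℝ × ℝ => (F'.restrict w, (w t).1)) ⁻¹' ((r ⁻¹' S) ×ˢ A) =
          shift (-(n : ℤ)) ⁻¹' cylinder F S ∩ a := by
        ext w
        simp only [Set.mem_preimage, Set.mem_prod, Set.mem_inter_iff, mem_cylinder, ha]
        rfl
      rw [e, Set.inter_assoc] at hind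
      simp only [D]
      rw [measureReal_def, hind, ENNReal.toReal_mul]
      simp [measureReal_def, hb]
    · intro J hJ hD
      have : D Jᶜ = fun n => - D J n := by
        ext n
        have e1 := measureReal_inter_add_sdiff (μ := Q) (s := a ∩ b) (hm n hJ)
        have e2 := measureReal_inter_add_sdiff (μ := Q) (s := a) (hm n hJ)
        simp only [D, Set.preimage_compl]
        rw [Set.inter_comm _ (a ∩ b), Set.inter_comm _ a, ← Set.sdiff_eq, ← Set.sdiff_eq,
          Set.inter_comm _ (a ∩ b), Set.inter_comm _ a]
        linear_combination e1 - Q.real b * e2 + hab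
      rw [this]
      simpa using hD.neg
    · intro J hdisj hJ hD
      have hsum : ∀ (c : Set (ℤ → ℝ × ℝ)) (n : ℕ), MeasurableSet c →
          HasSum (fun i => Q.real (shift (-(n : ℤ)) ⁻¹' J i ∩ c))
            (Q.real (shift (-(n : ℤ)) ⁻¹' (⋃ i, J i) ∩ c)) := by
        intro c n hc
        rw [Set.preimage_iUnion, Set.iUnion_inter, measureReal_def, measure_iUnion
          (fun i j hij => ((hdisj hij).preimage _).mono Set.inter_subset_left Set.inter_subset_left)
          fun i => (hm n (hJ i)).inter hc]
        rw [ENNReal.tsum_toReal_eq fun i => measure_ne_top _ _]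
        refine (ENNReal.summable_toReal ?_).hasSum
        rw [← measure_iUnion
          (fun i j hij => ((hdisj hij).preimage _).mono Set.inter_subset_left Set.inter_subset_left)
          fun i => (hm n (hJ i)).inter hc]
        exact measure_ne_top _ _
      have hDs : ∀ n, ∑' i, D (J i) n = D (⋃ i, J i) n := fun n =>
        ((hsum _ n (hma.inter hmb)).sub ((hsum _ n hma).mul_right _)).tsum_eq
      have hbound : Summable fun i => Q.real (J i) := by
        exact (hsum Set.univ 0 .univ).summable.congr fun i => by rw [Set.inter_univ, hQ 0 (hJ i)]
      have := tendsto_tsum_of_dominated_convergence (f := fun n i => D (J i) n) (g := fun _ => 0)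
        hbound hD (Eventually.of_forall fun n i => by
          have l1 : Q.real (shift (-(n : ℤ)) ⁻¹' J i ∩ (a ∩ b)) ≤ Q.real (J i) :=
            (measureReal_mono Set.inter_subset_left).trans (hQ n (hJ i)).le
          have l2 : Q.real (shift (-(n : ℤ)) ⁻¹' J i ∩ a) ≤ Q.real (J i) :=
            (measureReal_mono Set.inter_subset_left).trans (hQ n (hJ i)).le
          have l3 : Q.real b ≤ 1 := measureReal_le_one
          have l4 : 0 ≤ Q.real (shift (-(n : ℤ)) ⁻¹' J i ∩ (a ∩ b)) := measureReal_nonneg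
          have l5 : 0 ≤ Q.real (shift (-(n : ℤ)) ⁻¹' J i ∩ a) := measureReal_nonneg
          have l6 : 0 ≤ Q.real b := measureReal_nonneg
          rw [Real.norm_eq_abs, abs_le]
          constructor
          · simp only [D]; nlinarith
          · simp only [D]; nlinarith)
      simpa [hDs] using this
  have hDI : D I = fun _ => Q.real (I ∩ (a ∩ b)) - Q.real (I ∩ a) * Q.real b := by
    ext n; simp only [D, hinv]
  have h0 := tendsto_nhds_unique (hDI ▸ htend I hI) tendsto_const_nhds
  have h1 : Q.real (I ∩ (a ∩ b)) = Q.real (I ∩ a) * Q.real b := by linarith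
  rw [measureReal_def, measureReal_def, measureReal_def, ← ENNReal.toReal_mul,
    ENNReal.toReal_eq_toReal_iff' (measure_ne_top _ _)
      (ENNReal.mul_ne_top (measure_ne_top _ _) (measure_ne_top _ _))] at h1
  exact h1

end Ergodicity

/-! ### Ergodicity of the volatility path from uniqueness in law -/

section Ergodicity

variable {E : Type*} {M : Model E} {θ₀ : E}

lemma measurable_logPlus : Measurable logPlus :=
  measurable_ereal_toENNReal.comp ENNReal.log_monotone.measurable

/-- The path of squared volatilities and innovations. -/
def path {Ω : Type*} (Z v : ℤ → Ω → ℝ) (ω : Ω) : ℤ → ℝ × ℝ := fun t => (v t ω, Z t ω)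

lemma Model.IsSolution.aemeasurable_path {Ω : Type*} [MeasurableSpace Ω] {P : Measure Ω}
    {Z v : ℤ → Ω → ℝ} (h : M.IsSolution θ₀ P Z v) (hZ : IsInnovation P Z) :
    AEMeasurable (path Z v) P :=
  aemeasurable_pi_iff.2 fun t => (h.aemeasurable t).prodMk (hZ.measurable t).aemeasurable

/-- The recursion as a measurable condition on the path. -/
lemma measurableSet_sre (M : Model E) (θ₀ : E) (t : ℤ) :
    MeasurableSet {w : ℤ → ℝ × ℝ | M.h (w (t + 1)).1 = M.ψ (w t).2 (M.h (w t).1) θ₀} :=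
  measurableSet_eq_fun (M.h_meas.comp (measurable_path_fst _))
    ((M.ψ_meas θ₀).comp ((measurable_path_snd t).prodMk (M.h_meas.comp (measurable_path_fst t))))

/-- Every clause in the definition of a solution depends only on the joint law of `v` and `Z`. -/
lemma Model.IsSolution.isSolutionLaw_map {Ω : Type*} [MeasurableSpace Ω] {P : Measure Ω}
    [IsProbabilityMeasure P] {Z v : ℤ → Ω → ℝ} (h : M.IsSolution θ₀ P Z v)
    (hZ : IsInnovation P Z) : M.IsSolutionLaw θ₀ (P.map (path Z v)) := by
  have hW := h.aemeasurable_path hZ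
  have : IsProbabilityMeasure (P.map (path Z v)) := Measure.isProbabilityMeasure_map hW
  have hmap : ∀ {β : Type} [MeasurableSpace β] {g : (ℤ → ℝ × ℝ) → β}, Measurable g →
      IdentDistrib g (g ∘ path Z v) (P.map (path Z v)) P := fun hg =>
    ⟨hg.aemeasurable, hg.comp_aemeasurable hW,
      (AEMeasurable.map_map_of_aemeasurable hg.aemeasurable hW)⟩
  have hz : ∀ t, IdentDistrib (fun w : ℤ → ℝ × ℝ => (w t).2) (Z t) (P.map (path Z v)) P :=
    fun t => hmap (measurable_path_snd t)
  have hzseq : IdentDistrib (fun (w : ℤ → ℝ × ℝ) (t : ℤ) => (w t).2) (fun ω t => Z t ω)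
      (P.map (path Z v)) P := hmap (measurable_pi_lambda _ fun t => measurable_path_snd t)
  refine ⟨⟨measurable_path_snd, ?_, fun t => ((hz t).trans (hZ.ident t)).trans (hz 0).symm,
    (hz 0).memLp_iff.2 hZ.memLp, (hz 0).integral_eq.trans hZ.mean, ?_⟩,
    ⟨fun k => ?_, fun t => ?_, fun t => ?_, fun t => ?_, ?_⟩⟩
  · rw [iIndepFun_iff_map_fun_eq_infinitePi_map measurable_path_snd, hzseq.map_eq,
      iIndepFun.map_fun_eq_infinitePi_map hZ.measurable hZ.indep]
    congr 1
    ext1 t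
    exact (hz t).map_eq.symm
  · exact ((hz 0).comp (measurable_id.pow_const 2)).integral_eq.trans hZ.var
  · exact ((hmap (g := fun (w : ℤ → ℝ × ℝ) (t : ℤ) => (w (t + k)).1)
      (measurable_pi_lambda _ fun t => measurable_path_fst (t + k))).trans (h.stationary k)).trans
      (hmap (measurable_pi_lambda _ fun t => measurable_path_fst t)).symm
  · exact (ae_map_iff hW (measurable_path_fst t M.dom_meas)).2 (h.mem_dom t)
  · exact (ae_map_iff hW (measurableSet_sre M θ₀ t)).2 (h.sre t)
  · have hm : Measurable fun (w : ℤ → ℝ × ℝ) (n : ℕ) => (w (t + n)).2 :=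
      measurable_pi_lambda _ fun n => measurable_path_snd _
    have := indepFun_iff_measure_inter_preimage_eq_mul.1 (h.nonanticipative t)
    refine indepFun_iff_measure_inter_preimage_eq_mul.2 fun A B hA hB => ?_
    rw [Measure.map_apply_of_aemeasurable hW ((measurable_path_fst t hA).inter (hm hB)),
      Measure.map_apply_of_aemeasurable hW (measurable_path_fst t hA),
      Measure.map_apply_of_aemeasurable hW (hm hB)]
    exact this A B hA hB
  · exact (lintegral_map' (measurable_logPlus.comp
      (ENNReal.measurable_ofReal.comp (measurable_path_fst 0))).aemeasurable hW).trans_lt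
      h.logMoment

/-- Conditioning on a shift invariant event preserves the laws of solutions. -/
lemma Model.IsSolutionLaw.cond {Q : Measure (ℤ → ℝ × ℝ)} [IsProbabilityMeasure Q]
    (h : M.IsSolutionLaw θ₀ Q) {I : Set (ℤ → ℝ × ℝ)} (hI : MeasurableSet I)
    (hinv : ∀ k, shift k ⁻¹' I = I) (hpos : Q I ≠ 0) :
    M.IsSolutionLaw θ₀ Q[|I] ∧ IdentDistrib (fun w => (w 0).2) (fun w => (w 0).2) Q[|I] Q := by
  have : IsProbabilityMeasure Q[|I] := cond_isProbabilityMeasure hpos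
  have hm : ∀ t, Measurable fun (w : ℤ → ℝ × ℝ) (n : ℕ) => (w (t + n)).2 :=
    fun t => measurable_pi_lambda _ fun n => measurable_path_snd _
  have hfut : ∀ t {B : Set (ℕ → ℝ)}, MeasurableSet B →
      Q[|I] ((fun w (n : ℕ) => (w (t + n)).2) ⁻¹' B) =
        Q ((fun w (n : ℕ) => (w (t + n)).2) ⁻¹' B) := by
    intro t B hB
    have := h.measure_inter_of_invariant hI hinv t .univ hB
    simp only [Set.preimage_univ, Set.univ_inter, Set.inter_univ] at this
    rw [cond_apply hI, this, ← mul_assoc, ENNReal.inv_mul_cancel hpos (measure_ne_top _ _), one_mul]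
  have hz : ∀ t, IdentDistrib (fun w : ℤ → ℝ × ℝ => (w t).2) (fun w => (w t).2) Q[|I] Q := by
    refine fun t => ⟨(measurable_path_snd t).aemeasurable, (measurable_path_snd t).aemeasurable, ?_⟩
    ext A hA
    rw [Measure.map_apply (measurable_path_snd t) hA, Measure.map_apply (measurable_path_snd t) hA]
    simpa [Set.preimage_preimage] using hfut t (measurable_pi_apply 0 hA)
  refine ⟨⟨⟨measurable_path_snd, ?_, fun t => ((hz t).trans (h.innovation.ident t)).trans
    (hz 0).symm, (hz 0).memLp_iff.2 h.innovation.memLp,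
    (hz 0).integral_eq.trans h.innovation.mean, ?_⟩, ⟨fun k => ?_, fun t => ?_, fun t => ?_,
    fun t => ?_, ?_⟩⟩, hz 0⟩
  · refine iIndepFun_iff_measure_inter_preimage_eq_mul.2 fun F A hA => ?_
    obtain ⟨s, hs⟩ := F.bddBelow
    have e : ∀ i ∈ F, s + ((i - s).toNat : ℤ) = i := by
      intro i hi
      rw [Int.toNat_of_nonneg (sub_nonneg.2 (hs hi))]; ring
    have hB : MeasurableSet (⋂ i ∈ F, (fun z : ℕ → ℝ => z (i - s).toNat) ⁻¹' A i) :=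
      Finset.measurableSet_biInter F fun i hi => measurable_pi_apply _ (hA i hi)
    have hpre : (fun (w : ℤ → ℝ × ℝ) (n : ℕ) => (w (s + n)).2) ⁻¹'
        (⋂ i ∈ F, (fun z : ℕ → ℝ => z (i - s).toNat) ⁻¹' A i) =
        ⋂ i ∈ F, (fun w : ℤ → ℝ × ℝ => (w i).2) ⁻¹' A i := by
      ext w
      simp only [Set.mem_preimage, Set.mem_iInter]
      exact forall₂_congr fun i hi => by rw [e i hi]
    have := hfut s hB
    rw [hpre] at this
    rw [this, iIndepFun_iff_measure_inter_preimage_eq_mul.1 h.innovation.indep F hA]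
    refine Finset.prod_congr rfl fun i hi => ?_
    exact ((hz i).measure_preimage_eq (hA i hi)).symm
  · exact ((hz 0).comp (measurable_id.pow_const 2)).integral_eq.trans h.innovation.var
  · have hm1 : Measurable fun (w : ℤ → ℝ × ℝ) (t : ℤ) => (w (t + k)).1 :=
      measurable_pi_lambda _ fun t => measurable_path_fst _
    have hm0 : Measurable fun (w : ℤ → ℝ × ℝ) (t : ℤ) => (w t).1 :=
      measurable_pi_lambda _ fun t => measurable_path_fst _
    refine ⟨hm1.aemeasurable, hm0.aemeasurable, ?_⟩
    ext A hA
    rw [Measure.map_apply hm1 hA, Measure.map_apply hm0 hA, cond_apply hI, cond_apply hI,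
      ← (h.measurePreserving_shift k).measure_preimage (hI.inter (hm0 hA)).nullMeasurableSet,
      Set.preimage_inter, hinv]
    rfl
  · exact cond_absolutelyContinuous.ae_le (h.solution.mem_dom t)
  · exact cond_absolutelyContinuous.ae_le (h.solution.sre t)
  · refine indepFun_iff_measure_inter_preimage_eq_mul.2 fun A B hA hB => ?_
    rw [hfut t hB, cond_apply hI, cond_apply hI, h.measure_inter_of_invariant hI hinv t hA hB,
      mul_assoc]
  · rw [ProbabilityTheory.cond, lintegral_smul_measure]
    exact ENNReal.mul_lt_top (ENNReal.inv_lt_top.2 (pos_iff_ne_zero.2 hpos))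
      ((setLIntegral_le_lintegral _ _).trans_lt h.solution.logMoment)

/-- Uniqueness of the stationary solution makes it ergodic. -/
theorem Model.ST.measure_eq_zero_or_one {Ω : Type*} [MeasurableSpace Ω] {P : Measure Ω}
    [IsProbabilityMeasure P] {Z v : ℤ → Ω → ℝ} (hST : M.ST θ₀ P Z v) (hZ : IsInnovation P Z)
    {I : Set (ℤ → ℝ × ℝ)} (hI : MeasurableSet I) (hinv : ∀ k, shift k ⁻¹' I = I) :
    P.map (path Z v) I = 0 ∨ P.map (path Z v) I = 1 := by
  have hW := hST.solution.aemeasurable_path hZ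
  have : IsProbabilityMeasure (P.map (path Z v)) := Measure.isProbabilityMeasure_map hW
  have hQ := hST.solution.isSolutionLaw_map hZ
  refine or_iff_not_imp_left.2 fun hpos => ?_
  obtain ⟨hQI, hz⟩ := hQ.cond hI hinv hpos
  have : IsProbabilityMeasure (P.map (path Z v))[|I] := cond_isProbabilityMeasure hpos
  have hz0 : IdentDistrib (fun w : ℤ → ℝ × ℝ => (w 0).2) (Z 0) (P.map (path Z v)) P :=
    ⟨(measurable_path_snd 0).aemeasurable, (hZ.measurable 0).aemeasurable,
      AEMeasurable.map_map_of_aemeasurable (measurable_path_snd 0).aemeasurable hW⟩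
  have hv0 : IdentDistrib (fun w : ℤ → ℝ × ℝ => (w 0).1) (v 0) (P.map (path Z v)) P :=
    ⟨(measurable_path_fst 0).aemeasurable, hST.solution.aemeasurable 0,
      AEMeasurable.map_map_of_aemeasurable (measurable_path_fst 0).aemeasurable hW⟩
  -- Uniqueness is used on the path space itself, under the conditioned law; only the marginal at
  -- time `0` of its conclusion is kept.
  have hv := (hST.unique _ _ _ _ hQI.innovation (hz.trans hz0) hQI.solution).comp
    (measurable_pi_apply 0)
  rw [← hQI.ext hQ (hv.map_eq.trans hv0.map_eq.symm) hz.map_eq, cond_apply_self]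
  · exact hpos
  · exact measure_ne_top _ _

/-- Invariance under `shift 1` or `shift (-1)` generates invariance under all shifts. Both
directions of time matter: backwards for constructing `g`, forwards for the approximation. -/
theorem Model.ST.ergodic_shift {Ω : Type*} [MeasurableSpace Ω] {P : Measure Ω}
    [IsProbabilityMeasure P] {Z v : ℤ → Ω → ℝ} (hST : M.ST θ₀ P Z v) (hZ : IsInnovation P Z)
    {k : ℤ} (hk : k = 1 ∨ k = -1) : Ergodic (shift k) (P.map (path Z v)) := by
  have hW := hST.solution.aemeasurable_path hZ
  have : IsProbabilityMeasure (P.map (path Z v)) := Measure.isProbabilityMeasure_map hW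
  refine ⟨(hST.solution.isSolutionLaw_map hZ).measurePreserving_shift k, ⟨fun I hI hinv => ?_⟩⟩
  have hinv0 : shift 0 ⁻¹' I = I := by
    have : shift 0 = (id : (ℤ → ℝ × ℝ) → _) := by ext1 w; funext t; simp
    rw [this, Set.preimage_id]
  have hcomp : ∀ a b : ℤ, shift a ⁻¹' I = I → shift b ⁻¹' I = I → shift (a + b) ⁻¹' I = I := by
    intro a b ha hb
    have : (shift (a + b) : (ℤ → ℝ × ℝ) → _) = shift a ∘ shift b := by
      funext w; exact (shift_shift a b w).symm
    rw [this, Set.preimage_comp, ha, hb]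
  have hneg : ∀ a : ℤ, shift a ⁻¹' I = I → shift (-a) ⁻¹' I = I := by
    intro a ha
    conv_lhs => rw [← ha]
    rw [← Set.preimage_comp]
    have : (shift a ∘ shift (-a) : (ℤ → ℝ × ℝ) → _) = shift 0 := by
      funext w; simp [shift_shift]
    rw [this, hinv0]
  have h1 : shift 1 ⁻¹' I = I := by
    rcases hk with rfl | rfl
    · exact hinv
    · exact hneg _ hinv
  have hnat : ∀ n : ℕ, shift (n : ℤ) ⁻¹' I = I := by
    intro n
    induction n with
    | zero => exact hinv0
    | succ n ih => push_cast; exact hcomp _ _ ih h1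
  have hall : ∀ l : ℤ, shift l ⁻¹' I = I := by
    intro l
    rcases Int.eq_nat_or_neg l with ⟨n, rfl | rfl⟩
    · exact hnat n
    · exact hneg _ (hnat n)
  rw [eventuallyConst_set']
  rcases hST.measure_eq_zero_or_one hZ hI hall with h | h
  · exact Or.inl (ae_eq_empty.2 h)
  · exact Or.inr (ae_eq_univ.2 ((prob_compl_eq_zero_iff hI).2 h))

end Ergodicity

/-! ### Contraction of compositions of Lipschitz maps -/

lemma le_mul_exp_sum_of_le_mul_exp {α D : ℕ → ℝ}
    (h1 : ∀ n, D (n + 1) ≤ Real.exp (α n) * D n) (n j : ℕ) :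
    D (n + j) ≤ Real.exp (∑ i ∈ Finset.range j, α (n + i)) * D n := by
  induction j with
  | zero => simp
  | succ j ih =>
    rw [Finset.sum_range_succ, add_comm (∑ i ∈ _, _), Real.exp_add, mul_assoc]
    exact (h1 (n + j)).trans (mul_le_mul_of_nonneg_left ih (Real.exp_pos _).le)

/-- A bound for a sequence which is multiplied by at most `exp (α n)` in the `n`-th step and by
at most `exp (β n)` in the `r` steps that start with the `n`-th one: the steps of length `r` may be
counted with any residue mod `r`, hence with the average over all residues. -/
lemma le_mul_exp_of_le_mul_exp {r : ℕ} (hr : 1 ≤ r) {α β D : ℕ → ℝ} (hα : ∀ n, 0 ≤ α n)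
    (hD : ∀ n, 0 ≤ D n) (h1 : ∀ n, D (n + 1) ≤ Real.exp (α n) * D n)
    (h2 : ∀ n, D (n + r) ≤ Real.exp (β n) * D n) (n : ℕ) :
    D (n + r) ≤ Real.exp ((∑ i ∈ Finset.range r, α i) + (∑ i ∈ Finset.range n, β i) / r +
      ∑ i ∈ Finset.range r, α (n + i)) * D 0 := by
  have hr0 : (r : ℝ) ≠ 0 := by positivity
  -- Follow the product of `r` consecutive terms: sliding this window by one replaces `D n` by `D (n
  -- + r)` and costs one factor `exp (β n)`. So `β` is summed over all times, and ergodicity of the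
  -- one-step shift suffices, without that of its `r`-th power.
  have hP : ∀ n, ∏ j ∈ Finset.range r, D (n + j) ≤
      Real.exp (∑ i ∈ Finset.range n, β i) * ∏ j ∈ Finset.range r, D j := by
    intro n
    induction n with
    | zero => simp
    | succ n ih =>
      obtain ⟨q, rfl⟩ : ∃ q, r = q + 1 := ⟨r - 1, by omega⟩
      have hstep : ∏ j ∈ Finset.range (q + 1), D (n + 1 + j) ≤
          Real.exp (β n) * ∏ j ∈ Finset.range (q + 1), D (n + j) := by
        rw [Finset.prod_range_succ, Finset.prod_range_succ' (fun j => D (n + j))]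
        have e : ∏ j ∈ Finset.range q, D (n + (j + 1)) = ∏ j ∈ Finset.range q, D (n + 1 + j) :=
          Finset.prod_congr rfl fun j _ => by rw [show n + (j + 1) = n + 1 + j by ring]
        rw [e, add_zero, show n + 1 + q = n + (q + 1) by ring, mul_left_comm]
        exact mul_le_mul_of_nonneg_left (h2 n) (Finset.prod_nonneg fun _ _ => hD _)
      rw [Finset.sum_range_succ, add_comm (∑ i ∈ _, _), Real.exp_add, mul_assoc]
      exact hstep.trans (mul_le_mul_of_nonneg_left ih (Real.exp_pos _).le)
  have hmono : ∀ m j k : ℕ, j ≤ k → ∑ i ∈ Finset.range j, α (m + i) ≤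
      ∑ i ∈ Finset.range k, α (m + i) := fun m j k hjk =>
    Finset.sum_le_sum_of_subset_of_nonneg (Finset.range_mono hjk) fun _ _ _ => hα _
  have hP0 : ∏ j ∈ Finset.range r, D j ≤
      (Real.exp (∑ i ∈ Finset.range r, α i) * D 0) ^ r := by
    refine (Finset.prod_le_prod (fun _ _ => hD _) fun j hj => ?_).trans_eq
      ((Finset.prod_const _).trans (by rw [Finset.card_range]))
    have h := le_mul_exp_sum_of_le_mul_exp h1 0 j
    have h' := hmono 0 j r (Finset.mem_range.1 hj).le
    simp only [zero_add] at h h'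
    exact h.trans (mul_le_mul_of_nonneg_right (Real.exp_le_exp.2 h') (hD 0))
  -- Each term of the last window reaches `D (n + r)` in at most `r` single steps; an `r`-th root
  -- then closes the estimate.
  have hlast : D (n + r) ^ r ≤
      Real.exp (∑ i ∈ Finset.range r, α (n + i)) ^ r * ∏ j ∈ Finset.range r, D (n + j) := by
    have hc : ∀ c : ℝ, c ^ r = ∏ _j ∈ Finset.range r, c := fun c => by
      rw [Finset.prod_const, Finset.card_range]
    rw [hc, hc, ← Finset.prod_mul_distrib]
    refine Finset.prod_le_prod (fun _ _ => hD _) fun j hj => ?_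
    obtain ⟨k, rfl⟩ : ∃ k, r = j + k := ⟨r - j, by have := Finset.mem_range.1 hj; omega⟩
    have h := le_mul_exp_sum_of_le_mul_exp h1 (n + j) k
    rw [← add_assoc]
    refine h.trans (mul_le_mul_of_nonneg_right (Real.exp_le_exp.2 ?_) (hD _))
    rw [Finset.sum_range_add]
    simp only [add_assoc]
    exact le_add_of_nonneg_left (Finset.sum_nonneg fun _ _ => hα _)
  refine le_of_pow_le_pow_left₀ (n := r) (by omega) (mul_nonneg (Real.exp_pos _).le (hD 0)) ?_
  refine hlast.trans ((mul_le_mul_of_nonneg_left ((hP n).trans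
    (mul_le_mul_of_nonneg_left hP0 (Real.exp_pos _).le)) (by positivity)).trans_eq ?_)
  rw [mul_pow, mul_pow, ← Real.exp_nat_mul, ← Real.exp_nat_mul, ← Real.exp_nat_mul, ← mul_assoc,
    ← mul_assoc, ← Real.exp_add, ← Real.exp_add]
  congr 2
  field_simp
  ring

/-- The slopes add up to `ε / (2r) - ε / r = -ε / (2r)`; half of this is given up to absorb the
constants and the shift from `n` to `n + r`. -/
lemma eventually_exponent_le {r : ℕ} (hr : 1 ≤ r) {ε C₁ C₂ : ℝ} (hε : 0 < ε) {A S : ℕ → ℝ}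
    (hA : ∀ n, A n ≤ C₁ + ε / (2 * r) * n) (hS : ∀ n, S n ≤ C₂ + -ε * n) :
    ∀ᶠ n : ℕ in atTop, A n + S n / r ≤ -(ε / (4 * r)) * (n + r : ℕ) := by
  have hr0 : (0 : ℝ) < r := by positivity
  obtain ⟨N, hN⟩ := exists_nat_ge ((C₁ + C₂ / r + ε / 4) / (ε / (4 * r)))
  filter_upwards [eventually_ge_atTop N] with n hn
  have h1 : S n / r ≤ C₂ / r - ε / r * n := by
    rw [div_le_iff₀ hr0]
    have : (C₂ / r - ε / r * n) * r = C₂ + -ε * n := by field_simp; ring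
    rw [this]; exact hS n
  have h2 : C₁ + C₂ / r + ε / 4 ≤ ε / (4 * r) * n := by
    rw [div_le_iff₀ (by positivity)] at hN
    have : (N : ℝ) ≤ n := by exact_mod_cast hn
    calc _ ≤ _ := hN
      _ = ε / (4 * r) * N := mul_comm _ _
      _ ≤ _ := by gcongr
  have h3 := hA n
  push_cast
  have e1 : ε / (4 * r) * (n + r) = ε / (4 * r) * n + ε / 4 := by field_simp
  have e2 : ε / (2 * r) * n = 2 * (ε / (4 * r) * n) := by field_simp; ring
  have e3 : ε / r * n = 4 * (ε / (4 * r) * n) := by field_simp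
  rw [e3] at h1
  rw [e2] at h3
  rw [neg_mul, e1]
  linarith

/-! ### Algebra and contraction of compositions of successive maps -/

section Iterates

variable {E : Type*}

lemma iter_add (f : ℤ → ℝ → E → ℝ) (r k : ℕ) (t : ℤ) (x : ℝ) (θ : E) :
    iter f (r + k) t x θ = iter f r t (iter f k (t - r) x θ) θ := by
  induction r generalizing t with
  | zero => simp [iter]
  | succ r ih =>
    rw [show r + 1 + k = (r + k) + 1 by ring]
    simp only [iter]
    rw [ih]
    push_cast
    rw [sub_sub, add_comm (1 : ℤ)]

lemma iter_shift (f : ℤ → ℝ → E → ℝ) (s : ℤ) (r : ℕ) (t : ℤ) :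
    iter (fun u => f (u + s)) r t = iter f r (t + s) := by
  induction r generalizing t with
  | zero => rfl
  | succ r ih =>
    simp only [iter, ih]
    rw [show t - 1 + s = t + s - 1 by ring]

lemma iter_mem {f : ℤ → ℝ → E → ℝ} {K : Set ℝ} {θ : E} (hf : ∀ t, ∀ x ∈ K, f t x θ ∈ K) (r : ℕ)
    (t : ℤ) {x : ℝ} (hx : x ∈ K) : iter f r t x θ ∈ K := by
  induction r generalizing t with
  | zero => exact hx
  | succ r ih => exact hf t _ (ih (t - 1))

/-- Contraction of the composition of the maps from time `s` to time `s + n + r - 1`. -/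
lemma abs_iter_sub_iter_le {f : ℤ → ℝ → E → ℝ} {K : Set ℝ} {θ : E} {r : ℕ} (hr : 1 ≤ r)
    {a b : ℤ → ℝ} (hf : ∀ t, ∀ x ∈ K, f t x θ ∈ K) (ha : ∀ t, 0 ≤ a t)
    (h1 : ∀ t, ∀ x ∈ K, ∀ y ∈ K, |f t x θ - f t y θ| ≤ Real.exp (a t) * |x - y|)
    (h2 : ∀ t, ∀ x ∈ K, ∀ y ∈ K,
      |iter f r t x θ - iter f r t y θ| ≤ Real.exp (b t) * |x - y|)
    (s : ℤ) (n : ℕ) {x y : ℝ} (hx : x ∈ K) (hy : y ∈ K) :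
    |iter f (n + r) (s + n + r - 1) x θ - iter f (n + r) (s + n + r - 1) y θ| ≤
      Real.exp ((∑ i ∈ Finset.range r, a (s + i)) +
        (∑ i ∈ Finset.range n, b (s + i + r - 1)) / r +
        ∑ i ∈ Finset.range r, a (s + n + i)) * |x - y| := by
  have := le_mul_exp_of_le_mul_exp hr (α := fun i => a (s + i)) (β := fun i => b (s + i + r - 1))
    (D := fun k => |iter f k (s + k - 1) x θ - iter f k (s + k - 1) y θ|)
    (fun _ => ha _) (fun _ => abs_nonneg _) (fun k => ?_) (fun k => ?_) n
  · simpa [iter, add_assoc] using this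
  · have e : s + ((k + 1 : ℕ) : ℤ) - 1 = s + k := by push_cast; ring
    simp only [iter, e]
    exact h1 _ _ (iter_mem hf _ _ hx) _ (iter_mem hf _ _ hy)
  · have e : s + ((k + r : ℕ) : ℤ) - 1 = s + k + r - 1 := by push_cast; ring
    have e' : s + k + r - 1 - (r : ℤ) = s + k - 1 := by ring
    simp only [e]
    rw [add_comm k r, iter_add, iter_add, e']
    exact h2 _ _ (iter_mem hf _ _ hx) _ (iter_mem hf _ _ hy)

end Iterates

/-! ### Logarithmic moments -/

lemma logPlus_mono : Monotone logPlus := fun _ _ h =>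
  EReal.toENNReal_le_toENNReal (ENNReal.log_monotone h)

lemma logMinus_anti : Antitone logMinus := fun _ _ h =>
  EReal.toENNReal_le_toENNReal (EReal.neg_le_neg_iff.2 (ENNReal.log_monotone h))

lemma continuous_logPlus : Continuous logPlus :=
  EReal.continuous_toENNReal.comp ENNReal.continuous_log

lemma continuous_logMinus : Continuous logMinus :=
  EReal.continuous_toENNReal.comp (continuous_neg.comp ENNReal.continuous_log)

lemma logPlus_eq_top_iff {x : ℝ≥0∞} : logPlus x = ∞ ↔ x = ∞ := by
  rw [logPlus, EReal.toENNReal_eq_top_iff, ENNReal.log_eq_top_iff]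

lemma logPlus_mul_le (x y : ℝ≥0∞) : logPlus (x * y) ≤ logPlus x + logPlus y := by
  rw [logPlus, ENNReal.log_mul_add]
  exact EReal.toENNReal_add_le

lemma logPlus_prod_le {ι : Type*} (s : Finset ι) (x : ι → ℝ≥0∞) :
    logPlus (∏ i ∈ s, x i) ≤ ∑ i ∈ s, logPlus (x i) := by
  classical
  induction s using Finset.induction_on with
  | empty => simp [logPlus]
  | insert i s hi ih =>
    rw [Finset.prod_insert hi, Finset.sum_insert hi]
    exact (logPlus_mul_le _ _).trans (add_le_add le_rfl ih)

/-- `log x = log⁺ x - log⁻ x`, and lowering `log⁻ x` to `m` only weakens the bound. A truncation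
serves as `m` for the `r`-fold maps, `m = 0` for the single maps. -/
lemma le_ofReal_exp_logPlus {x : ℝ≥0∞} (hx : x ≠ ∞) {m : ℝ≥0∞} (hm : m ≤ logMinus x) :
    x ≤ ENNReal.ofReal (Real.exp ((logPlus x).toReal - m.toReal)) := by
  rcases eq_or_ne x 0 with rfl | h0
  · exact zero_le
  have hpos : 0 < x.toReal := ENNReal.toReal_pos h0 hx
  have hlog : ENNReal.log x = Real.log x.toReal := by
    rw [ENNReal.log_pos_real h0 hx]
  have hP : (logPlus x).toReal = max (Real.log x.toReal) 0 := by
    rw [logPlus, hlog, EReal.real_coe_toENNReal, ENNReal.toReal_ofReal']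
  have hM : logMinus x = ENNReal.ofReal (-Real.log x.toReal) := by
    rw [logMinus, hlog, ← EReal.coe_neg, EReal.real_coe_toENNReal]
  have hm' : m.toReal ≤ max (-Real.log x.toReal) 0 := by
    rw [← ENNReal.toReal_ofReal', ← hM]
    exact ENNReal.toReal_mono (by rw [hM]; exact ENNReal.ofReal_ne_top) hm
  conv_lhs => rw [← ENNReal.ofReal_toReal hx, ← Real.exp_log hpos]
  refine ENNReal.ofReal_le_ofReal (Real.exp_le_exp.2 ?_)
  rw [hP]
  rcases le_total (Real.log x.toReal) 0 with h | h
  · rw [max_eq_left (neg_nonneg.2 h)] at hm'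
    rw [max_eq_right h]; linarith
  · rw [max_eq_right (neg_nonpos.2 h)] at hm'
    rw [max_eq_left h]; linarith

/-- If `E log G < 0`, then `G` is dominated by the exponential of an integrable function with a
negative mean. -/
lemma exists_integrable_le_exp {α : Type*} [MeasurableSpace α] {μ : Measure α} [IsFiniteMeasure μ]
    {G : α → ℝ≥0∞} (hG : Measurable G) (h : ∫⁻ w, logPlus (G w) ∂μ < ∫⁻ w, logMinus (G w) ∂μ) :
    ∃ F : α → ℝ, Measurable F ∧ Integrable F μ ∧ ∫ w, F w ∂μ < 0 ∧
      ∀ᵐ w ∂μ, G w ≤ ENNReal.ofReal (Real.exp (F w)) := by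
  have hmP : Measurable fun w => logPlus (G w) := continuous_logPlus.measurable.comp hG
  have hmM : Measurable fun w => logMinus (G w) := continuous_logMinus.measurable.comp hG
  -- `log⁻` may have infinite mean; by monotone convergence a truncation at some level `N` keeps the
  -- strict inequality and is integrable.
  obtain ⟨N, hN⟩ : ∃ N : ℕ, ∫⁻ w, logPlus (G w) ∂μ < ∫⁻ w, min (logMinus (G w)) N ∂μ := by
    have : ∫⁻ w, logMinus (G w) ∂μ = ⨆ N : ℕ, ∫⁻ w, min (logMinus (G w)) N ∂μ := by
      rw [← lintegral_iSup (fun N => hmM.min measurable_const)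
        fun m n hmn w => min_le_min le_rfl (by exact_mod_cast hmn)]
      refine lintegral_congr fun w => ?_
      rw [← inf_iSup_eq, ENNReal.iSup_natCast, inf_top_eq]
    rw [this] at h
    exact lt_iSup_iff.1 h
  have hfinP : ∫⁻ w, logPlus (G w) ∂μ ≠ ∞ := h.ne_top
  have hfinM : ∫⁻ w, min (logMinus (G w)) N ∂μ ≠ ∞ := by
    refine ((lintegral_mono fun w => min_le_right _ _).trans_lt ?_).ne
    rw [lintegral_const]
    exact ENNReal.mul_lt_top (ENNReal.natCast_lt_top N) (measure_lt_top _ _)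
  have hiP := integrable_toReal_of_lintegral_ne_top hmP.aemeasurable hfinP
  have hiM := integrable_toReal_of_lintegral_ne_top (hmM.min measurable_const).aemeasurable hfinM
  refine ⟨fun w => (logPlus (G w)).toReal - (min (logMinus (G w)) N).toReal,
    hmP.ennreal_toReal.sub (hmM.min measurable_const).ennreal_toReal, hiP.sub hiM, ?_, ?_⟩
  · rw [integral_sub hiP hiM, integral_toReal hmP.aemeasurable (ae_lt_top hmP hfinP),
      integral_toReal (hmM.min measurable_const).aemeasurable
        (ae_lt_top (hmM.min measurable_const) hfinM), sub_neg]
    exact (ENNReal.toReal_lt_toReal hfinP hfinM).2 hN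
  · filter_upwards [ae_lt_top hmP hfinP] with w hw
    exact le_ofReal_exp_logPlus (fun hx => hw.ne (logPlus_eq_top_iff.2 hx)) (min_le_left _ _)

lemma limsup_lintegral_le_of_aemeasurable {α : Type*} [MeasurableSpace α] {μ : Measure α}
    {f : ℕ → α → ℝ≥0∞} (g : α → ℝ≥0∞) (hf : ∀ n, AEMeasurable (f n) μ)
    (hfg : ∀ n, f n ≤ᵐ[μ] g) (hg : ∫⁻ a, g a ∂μ ≠ ∞) :
    limsup (fun n => ∫⁻ a, f n a ∂μ) atTop ≤ ∫⁻ a, limsup (fun n => f n a) atTop ∂μ := by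
  have h := limsup_lintegral_le g (fun n => (hf n).measurable_mk)
    (fun n => (hf n).ae_eq_mk.symm.le.trans (hfg n)) hg
  simp_rw [← lintegral_congr_ae (hf _).ae_eq_mk] at h
  refine h.trans_eq (lintegral_congr_ae ?_)
  filter_upwards [ae_all_iff.2 fun n => (hf n).ae_eq_mk] with a ha
  simp only [ha]

/-- If the superior limit of `G n` is at most `L` with `E log L < 0` and the `G n` are dominated by
a function with a finite log-moment, then `E log (G n) < 0` eventually. -/
lemma eventually_lintegral_logPlus_lt {α : Type*} [MeasurableSpace α] {μ : Measure α}
    {G H : ℕ → α → ℝ≥0∞} {L : α → ℝ≥0∞} {B : α → ℝ≥0∞} (hG : ∀ n, AEMeasurable (G n) μ)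
    (hGH : ∀ᵐ w ∂μ, ∀ n, G n w ≤ H n w)
    (hlim : ∀ᵐ w ∂μ, Tendsto (fun n => H n w) atTop (𝓝 (L w)))
    (hB : ∀ n, ∀ᵐ w ∂μ, logPlus (G n w) ≤ B w) (hBfin : ∫⁻ w, B w ∂μ ≠ ∞)
    (h : ∫⁻ w, logPlus (L w) ∂μ < ∫⁻ w, logMinus (L w) ∂μ) :
    ∀ᶠ n in atTop, ∫⁻ w, logPlus (G n w) ∂μ < ∫⁻ w, logMinus (G n w) ∂μ := by
  -- Positive parts stay below `c` by the reverse Fatou lemma, which needs the domination by `B`;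
  -- negative parts stay above `c` by Fatou's lemma, which needs none.
  obtain ⟨c, hc1, hc2⟩ := exists_between h
  have hP : limsup (fun n => ∫⁻ w, logPlus (G n w) ∂μ) atTop < c := by
    have h1 : ∫⁻ w, limsup (fun n => logPlus (G n w)) atTop ∂μ ≤ ∫⁻ w, logPlus (L w) ∂μ := by
      refine lintegral_mono_ae ?_
      filter_upwards [hGH, hlim] with w h1 h2
      rw [← ((continuous_logPlus.tendsto _).comp h2).limsup_eq]
      exact limsup_le_limsup (Eventually.of_forall fun n => logPlus_mono (h1 n))
    refine lt_of_le_of_lt ?_ (h1.trans_lt hc1)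
    exact limsup_lintegral_le_of_aemeasurable B
      (fun n => continuous_logPlus.measurable.comp_aemeasurable (hG n)) hB hBfin
  have hM : c < liminf (fun n => ∫⁻ w, logMinus (G n w) ∂μ) atTop := by
    have h1 : ∫⁻ w, logMinus (L w) ∂μ ≤ ∫⁻ w, liminf (fun n => logMinus (G n w)) atTop ∂μ := by
      refine lintegral_mono_ae ?_
      filter_upwards [hGH, hlim] with w h1 h2
      rw [← ((continuous_logMinus.tendsto _).comp h2).liminf_eq]
      exact liminf_le_liminf (Eventually.of_forall fun n => logMinus_anti (h1 n))
    refine lt_of_lt_of_le (hc2.trans_le h1) ?_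
    exact lintegral_liminf_le' fun n =>
      continuous_logMinus.measurable.comp_aemeasurable (hG n)
  filter_upwards [eventually_lt_of_limsup_lt hP, eventually_lt_of_lt_liminf hM] with n h1 h2
  exact h1.trans h2

/-! ### Growth along two-sided paths -/

section Growth

variable {S : Type*} [MeasurableSpace S] {μ : Measure (ℤ → S)}

lemma ae_forall_shift (hμ : ∀ k, MeasurePreserving (shift k : (ℤ → S) → _) μ μ)
    {p : (ℤ → S) → Prop} (hp : ∀ᵐ w ∂μ, p w) : ∀ᵐ w ∂μ, ∀ t : ℤ, p (shift t w) :=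
  ae_all_iff.2 fun t => (hμ t).quasiMeasurePreserving.ae hp

lemma ae_exists_sum_shift_le [IsProbabilityMeasure μ]
    (hμ : ∀ k, MeasurePreserving (shift k : (ℤ → S) → _) μ μ)
    (herg : ∀ k : ℤ, k = 1 ∨ k = -1 → Ergodic (shift k) μ) {F : (ℤ → S) → ℝ}
    (hFm : Measurable F) (hF : Integrable F μ) {c : ℝ} (hc : ∫ w, F w ∂μ < c) :
    ∀ᵐ w ∂μ, ∀ t : ℤ,
      (∃ C : ℝ, ∀ n : ℕ, ∑ i ∈ Finset.range n, F (shift (t - i) w) ≤ C + c * n) ∧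
      ∃ C : ℝ, ∀ n : ℕ, ∑ i ∈ Finset.range n, F (shift (t + i) w) ≤ C + c * n := by
  filter_upwards [ae_forall_shift hμ
    (ae_exists_birkhoffSum_le (herg (-1) (Or.inr rfl)) hFm hF hc),
    ae_forall_shift hμ
    (ae_exists_birkhoffSum_le (herg 1 (Or.inl rfl)) hFm hF hc)] with w h1 h2 t
  have e1 : ∀ i : ℕ, (i : ℤ) * -1 + t = t - i := fun i => by ring
  have e2 : ∀ i : ℕ, (i : ℤ) * 1 + t = t + i := fun i => by ring
  have h1 := h1 t
  have h2 := h2 t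
  simp only [shift_iterate, shift_shift, e1] at h1
  simp only [shift_iterate, shift_shift, e2] at h2
  exact ⟨h1, h2⟩

lemma ae_exists_shift_le [IsProbabilityMeasure μ]
    (hμ : ∀ k, MeasurePreserving (shift k : (ℤ → S) → _) μ μ)
    (herg : ∀ k : ℤ, k = 1 ∨ k = -1 → Ergodic (shift k) μ) {F : (ℤ → S) → ℝ}
    (hFm : Measurable F) (hF : Integrable F μ) {ε : ℝ} (hε : 0 < ε) :
    ∀ᵐ w ∂μ, ∀ t : ℤ, (∃ C : ℝ, ∀ n : ℕ, F (shift (t - n) w) ≤ C + ε * n) ∧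
      ∃ C : ℝ, ∀ n : ℕ, F (shift (t + n) w) ≤ C + ε * n := by
  filter_upwards [ae_forall_shift hμ
    (ae_exists_comp_iterate_le (herg (-1) (Or.inr rfl)) hFm hF hε),
    ae_forall_shift hμ
    (ae_exists_comp_iterate_le (herg 1 (Or.inl rfl)) hFm hF hε)] with w h1 h2 t
  have e1 : ∀ i : ℕ, (i : ℤ) * -1 + t = t - i := fun i => by ring
  have e2 : ∀ i : ℕ, (i : ℤ) * 1 + t = t + i := fun i => by ring
  have h1 := h1 t
  have h2 := h2 t
  simp only [shift_iterate, shift_shift, e1] at h1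
  simp only [shift_iterate, shift_shift, e2] at h2
  exact ⟨h1, h2⟩

end Growth

/-! ### Lipschitz coefficients of random maps -/

section Lipschitz

variable {E : Type*}

/-- The maps `f_t` send `K × Θ` to `K` and are jointly continuous there. -/
structure IsContinuousFamily [TopologicalSpace E] (K : Set ℝ) (Θ : Set E) (f : ℤ → ℝ → E → ℝ) :
    Prop where
  mem : ∀ t, ∀ x ∈ K, ∀ θ ∈ Θ, f t x θ ∈ K
  continuousOn : ∀ t, ContinuousOn (fun p : ℝ × E => f t p.1 p.2) (K ×ˢ Θ)

lemma IsContinuousFamily.continuousOn_iter [TopologicalSpace E] {K : Set ℝ} {Θ : Set E}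
    {f : ℤ → ℝ → E → ℝ} (hf : IsContinuousFamily K Θ f) (r : ℕ) (t : ℤ) :
    ContinuousOn (fun p : ℝ × E => iter f r t p.1 p.2) (K ×ˢ Θ) := by
  induction r generalizing t with
  | zero => exact continuousOn_fst
  | succ r ih =>
    exact (hf.continuousOn t).comp ((ih (t - 1)).prodMk continuousOn_snd) fun p hp =>
      ⟨iter_mem (fun t x hx => hf.mem t x hx _ hp.2) r _ hp.1, hp.2⟩

variable {S : Type*}

/-- The supremum of the Lipschitz coefficients of the `r`-fold compositions up to time `0` over the
parameters in `B₀`, computed on `K₀`. -/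
noncomputable def lipSup (φ : S → ℝ → E → ℝ) (K₀ : Set ℝ) (B₀ : Set E) (r : ℕ) (w : ℤ → S) : ℝ≥0∞ :=
  ⨆ θ ∈ B₀, ⨆ x ∈ K₀, ⨆ y ∈ K₀,
    ‖iter (fun t => φ (w t)) r 0 x θ - iter (fun t => φ (w t)) r 0 y θ‖ₑ / ‖x - y‖ₑ

lemma lipSup_shift (φ : S → ℝ → E → ℝ) (K₀ : Set ℝ) (B₀ : Set E) (r : ℕ) (t : ℤ) (w : ℤ → S) :
    lipSup φ K₀ B₀ r (shift t w) = ⨆ θ ∈ B₀, ⨆ x ∈ K₀, ⨆ y ∈ K₀,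
    ‖iter (fun t => φ (w t)) r t x θ - iter (fun t => φ (w t)) r t y θ‖ₑ / ‖x - y‖ₑ := by
  have := iter_shift (fun t => φ (w t)) t r 0
  simp only [zero_add] at this
  simp only [lipSup, shift_apply, this]

lemma lipSup_shift_le {φ : S → ℝ → E → ℝ} {K₀ : Set ℝ} {B₀ : Set E} {r : ℕ} {t : ℤ}
    {w : ℤ → S} {c : ℝ≥0∞} (h : ∀ θ ∈ B₀, ∀ x ∈ K₀, ∀ y ∈ K₀,
      ‖iter (fun t => φ (w t)) r t x θ - iter (fun t => φ (w t)) r t y θ‖ₑ ≤ c * ‖x - y‖ₑ) :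
    lipSup φ K₀ B₀ r (shift t w) ≤ c := by
  rw [lipSup_shift]
  exact iSup₂_le fun θ hθ => iSup₂_le fun x hx => iSup₂_le fun y hy =>
    ENNReal.div_le_of_le_mul (h θ hθ x hx y hy)

lemma enorm_iter_sub_le_lipSup {φ : S → ℝ → E → ℝ} {K₀ : Set ℝ} {B₀ : Set E} (r : ℕ) (t : ℤ)
    (w : ℤ → S) {θ : E} (hθ : θ ∈ B₀) {x y : ℝ} (hx : x ∈ K₀) (hy : y ∈ K₀) :
    ‖iter (fun t => φ (w t)) r t x θ - iter (fun t => φ (w t)) r t y θ‖ₑ ≤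
      lipSup φ K₀ B₀ r (shift t w) * ‖x - y‖ₑ := by
  rcases eq_or_ne x y with rfl | hxy
  · simp
  · rw [← ENNReal.div_le_iff (by simpa [sub_eq_zero] using hxy) enorm_ne_top, lipSup_shift]
    exact le_iSup₂_of_le θ hθ (le_iSup₂_of_le x hx (le_iSup₂_of_le y hy le_rfl))

/-- Countable index sets make `lipSup` measurable; joint continuity carries the bound to their
closures. An infinite coefficient is set apart because multiplication by `∞` is not continuous. -/
lemma enorm_iter_sub_le_lipSup_of_subset_closure [TopologicalSpace E] {φ : S → ℝ → E → ℝ}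
    {K K₀ : Set ℝ} {Θ B₀ : Set E} {w : ℤ → S} (hf : IsContinuousFamily K Θ fun t => φ (w t))
    (hK : IsClosed K) (hK₀ : K₀ ⊆ K) (hKK₀ : K ⊆ closure K₀) (hΘ : IsClosed Θ) (hB₀ : B₀ ⊆ Θ)
    (r : ℕ) (t : ℤ) {θ : E} (hθ : θ ∈ closure B₀) {x y : ℝ} (hx : x ∈ K) (hy : y ∈ K) :
    ‖iter (fun t => φ (w t)) r t x θ - iter (fun t => φ (w t)) r t y θ‖ₑ ≤
      lipSup φ K₀ B₀ r (shift t w) * ‖x - y‖ₑ := by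
  rcases eq_or_ne x y with rfl | hxy
  · simp
  rcases eq_or_ne (lipSup φ K₀ B₀ r (shift t w)) ∞ with hc | hc
  · rw [hc, ENNReal.top_mul (by simpa [sub_eq_zero] using hxy)]
    exact le_top
  have hcl : closure (K₀ ×ˢ K₀ ×ˢ B₀) ⊆ K ×ˢ K ×ˢ Θ := by
    rw [closure_prod_eq, closure_prod_eq]
    have hk := closure_minimal hK₀ hK
    exact Set.prod_mono hk (Set.prod_mono hk (closure_minimal hB₀ hΘ))
  have hmem : (x, y, θ) ∈ closure (K₀ ×ˢ K₀ ×ˢ B₀) := by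
    rw [closure_prod_eq, closure_prod_eq]
    exact ⟨hKK₀ hx, hKK₀ hy, hθ⟩
  have hcont := hf.continuousOn_iter r t
  refine le_on_closure (s := K₀ ×ˢ K₀ ×ˢ B₀)
    (f := fun p => ‖iter (fun t => φ (w t)) r t p.1 p.2.2 -
      iter (fun t => φ (w t)) r t p.2.1 p.2.2‖ₑ)
    (g := fun p => lipSup φ K₀ B₀ r (shift t w) * ‖p.1 - p.2.1‖ₑ)
    (fun p hp => enorm_iter_sub_le_lipSup r t w hp.2.2 hp.1 hp.2.1) ?_ ?_ hmem
  · refine continuous_enorm.comp_continuousOn (ContinuousOn.sub ?_ ?_)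
    · exact hcont.comp (continuous_fst.prodMk (continuous_snd.comp continuous_snd)).continuousOn
        fun p hp => ⟨(hcl hp).1, (hcl hp).2.2⟩
    · exact hcont.comp continuous_snd.continuousOn fun p hp => (hcl hp).2
  · exact ((ENNReal.continuous_const_mul hc).comp (continuous_enorm.comp
      (continuous_fst.sub (continuous_fst.comp continuous_snd)))).continuousOn

/-- The Lipschitz coefficients of compositions are bounded by products. -/
lemma lipSup_le_prod [TopologicalSpace E] {φ : S → ℝ → E → ℝ}
    {K K₀ : Set ℝ} {Θ Θ₀ B₀ : Set E} {w : ℤ → S} (hf : IsContinuousFamily K Θ fun t => φ (w t))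
    (hK : IsClosed K) (hK₀ : K₀ ⊆ K) (hKK₀ : K ⊆ closure K₀) (hΘ : IsClosed Θ) (hΘ₀ : Θ₀ ⊆ Θ)
    (hΘΘ₀ : Θ ⊆ closure Θ₀) (hB₀ : B₀ ⊆ Θ) (r : ℕ) :
    lipSup φ K₀ B₀ r w ≤ ∏ i ∈ Finset.range r, lipSup φ K₀ Θ₀ 1 (shift (-(i : ℤ)) w) := by
  -- The induction runs over all of `K`, since iterates of points of `K₀` need not stay in `K₀`.
  have key : ∀ (r : ℕ) (t : ℤ), ∀ θ ∈ Θ, ∀ x ∈ K, ∀ y ∈ K,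
      ‖iter (fun t => φ (w t)) r t x θ - iter (fun t => φ (w t)) r t y θ‖ₑ ≤
        (∏ i ∈ Finset.range r, lipSup φ K₀ Θ₀ 1 (shift (t - i) w)) * ‖x - y‖ₑ := by
    intro r
    induction r with
    | zero => intro t θ hθ x hx y hy; simp [iter]
    | succ r ih =>
      intro t θ hθ x hx y hy
      have hm : ∀ t, ∀ x ∈ K, φ (w t) x θ ∈ K := fun t x hx => hf.mem t x hx _ hθ
      have h1 := enorm_iter_sub_le_lipSup_of_subset_closure hf hK hK₀ hKK₀ hΘ hΘ₀ 1 t (hΘΘ₀ hθ)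
        (iter_mem hm r (t - 1) hx) (iter_mem hm r (t - 1) hy)
      refine h1.trans ?_
      rw [Finset.prod_range_succ', mul_comm (∏ i ∈ _, _), mul_assoc]
      have e : ∀ i : ℕ, t - ((i + 1 : ℕ) : ℤ) = t - 1 - i := fun i => by push_cast; ring
      simp only [e, Nat.cast_zero, sub_zero]
      exact mul_le_mul_right (ih (t - 1) θ hθ x hx y hy) _
  have h0 : shift 0 w = w := by ext; simp
  conv_lhs => rw [← h0]
  refine lipSup_shift_le fun θ hθ x hx y hy => ?_
  simpa using key r 0 θ (hB₀ hθ) x (hK₀ hx) y (hK₀ hy)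

variable [MeasurableSpace S]

lemma measurable_iter {φ : S → ℝ → E → ℝ} {θ : E}
    (hφ : Measurable fun p : S × ℝ => φ p.1 p.2 θ) (r : ℕ) (t : ℤ) :
    Measurable fun p : (ℤ → S) × ℝ => iter (fun t => φ (p.1 t)) r t p.2 θ := by
  induction r generalizing t with
  | zero => exact measurable_snd
  | succ r ih =>
    exact hφ.comp (((measurable_pi_apply t).comp measurable_fst).prodMk (ih (t - 1)))

lemma measurable_lipSup {φ : S → ℝ → E → ℝ} (hφ : ∀ θ, Measurable fun p : S × ℝ => φ p.1 p.2 θ)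
    {K₀ : Set ℝ} (hK₀ : K₀.Countable) {B₀ : Set E} (hB₀ : B₀.Countable) (r : ℕ) :
    Measurable (lipSup φ K₀ B₀ r) := by
  have h : ∀ (x : ℝ) (θ : E), Measurable fun w : ℤ → S => iter (fun t => φ (w t)) r 0 x θ :=
    fun x θ => (measurable_iter (hφ θ) r 0).comp (measurable_id.prodMk measurable_const)
  exact .biSup _ hB₀ fun θ _ => .biSup _ hK₀ fun x _ => .biSup _ hK₀ fun y _ =>
    ((h x θ).sub (h y θ)).enorm.div_const _

end Lipschitz

/-! ### From the Lyapunov condition at a point to contraction near it -/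

section Contraction

variable {Ω S E : Type*} [MeasurableSpace Ω] [MeasurableSpace S] [MetricSpace E]
  {P : Measure Ω} [IsProbabilityMeasure P] {W : Ω → ℤ → S} {φ : S → ℝ → E → ℝ}
  {K K₀ : Set ℝ} {Θ Θ₀ : Set E}

omit [MeasurableSpace Ω] [MeasurableSpace S] in
lemma tendsto_iSup_ball {Θ : Set E} {L : Θ → ℝ≥0} (hL : Continuous L) (θ : Θ) :
    Tendsto (fun n : ℕ => ⨆ (θ' : Θ) (_ : dist θ' θ < 1 / ((n : ℝ) + 1)), (L θ' : ℝ≥0∞)) atTop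
      (𝓝 (L θ)) := by
  rw [tendsto_order]
  constructor
  · intro a ha
    refine Eventually.of_forall fun n => ha.trans_le ?_
    exact le_iSup₂_of_le θ (by rw [dist_self]; positivity) le_rfl
  · intro a ha
    obtain ⟨c, hc1, hc2⟩ := exists_between ha
    have hev : ∀ᶠ θ' in 𝓝 θ, (L θ' : ℝ≥0∞) < c :=
      ((ENNReal.continuous_coe.comp hL).tendsto θ).eventually (gt_mem_nhds hc1)
    obtain ⟨δ, hδ, hball⟩ := Metric.eventually_nhds_iff.1 hev
    filter_upwards [(tendsto_one_div_add_atTop_nhds_zero_nat (𝕜 := ℝ)).eventually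
      (gt_mem_nhds hδ)] with n hn
    exact (iSup₂_le fun θ' hθ' => (hball (hθ'.trans hn)).le).trans_lt hc2

omit [IsProbabilityMeasure P] in
/-- The Lyapunov condition at `θ` passes to the supremum of the Lipschitz coefficients over a
neighbourhood of `θ`. -/
lemma exists_ball_lyapunov (hW : AEMeasurable W P)
    (hμ : ∀ k, MeasurePreserving (shift k) (P.map W) (P.map W))
    (hφ : ∀ θ, Measurable fun p : S × ℝ => φ p.1 p.2 θ)
    (hf : ∀ᵐ ω ∂P, IsContinuousFamily K Θ fun t => φ (W ω t))
    (hK : IsClosed K) (hK₀c : K₀.Countable) (hK₀ : K₀ ⊆ K) (hKK₀ : K ⊆ closure K₀)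
    (hΘ : IsCompact Θ) (hΘ₀c : Θ₀.Countable) (hΘ₀ : Θ₀ ⊆ Θ) (hΘΘ₀ : Θ ⊆ closure Θ₀)
    (hfin : ∫⁻ ω, logPlus (lipSup φ K₀ Θ₀ 1 (W ω)) ∂P < ∞) (θ : Θ) (r : ℕ)
    (L : Ω → Θ → ℝ≥0) (hL : IsLipschitzBound P K Θ (fun ω => iter (fun t => φ (W ω t)) r 0) L)
    (hneg : MeanLogNeg P (fun ω => L ω θ)) :
    ∃ δ > 0, ∃ B₀ : Set E, B₀.Countable ∧ B₀ ⊆ Θ ∧ Metric.ball (θ : E) δ ∩ Θ ⊆ closure B₀ ∧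
      ∫⁻ w, logPlus (lipSup φ K₀ B₀ r w) ∂(P.map W) <
        ∫⁻ w, logMinus (lipSup φ K₀ B₀ r w) ∂(P.map W) := by
  have hB : ∀ n : ℕ, ∃ B₀ : Set E, B₀ ⊆ Metric.ball (θ : E) (1 / ((n : ℝ) + 1)) ∩ Θ ∧
      B₀.Countable ∧ Metric.ball (θ : E) (1 / ((n : ℝ) + 1)) ∩ Θ ⊆ closure B₀ := fun n =>
    (hΘ.isSeparable.mono Set.inter_subset_right).exists_countable_dense_subset
  choose B hBsub hBc hBd using hB
  have hm : ∀ n, Measurable (lipSup φ K₀ (B n) r) := fun n => measurable_lipSup hφ hK₀c (hBc n) r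
  have hm1 : Measurable fun w : ℤ → S => logPlus (lipSup φ K₀ Θ₀ 1 w) :=
    continuous_logPlus.measurable.comp (measurable_lipSup hφ hK₀c hΘ₀c 1)
  -- Over shrinking balls the coefficient is at most the supremum of `L`, which tends to `L θ` by
  -- continuity. That supremum has no assumed log-moment, so `log⁺` is dominated instead by the sum
  -- of `r` one-step terms, integrable by stationarity.
  have hev := eventually_lintegral_logPlus_lt (μ := P) (G := fun n ω => lipSup φ K₀ (B n) r (W ω))
    (H := fun n ω => ⨆ (θ' : Θ) (_ : dist θ' θ < 1 / ((n : ℝ) + 1)), (L ω θ' : ℝ≥0∞))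
    (L := fun ω => (L ω θ : ℝ≥0∞))
    (B := fun ω => ∑ i ∈ Finset.range r, logPlus (lipSup φ K₀ Θ₀ 1 (shift (-(i : ℤ)) (W ω))))
    (fun n => (hm n).comp_aemeasurable hW) ?_ ?_ (fun n => ?_) ?_ hneg
  · obtain ⟨n, hn⟩ := hev.exists
    refine ⟨1 / ((n : ℝ) + 1), by positivity, B n, hBc n, (hBsub n).trans Set.inter_subset_right,
      hBd n, ?_⟩
    rwa [lintegral_map' (f := fun w => logPlus (lipSup φ K₀ (B n) r w))
        (continuous_logPlus.measurable.comp (hm n)).aemeasurable hW,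
      lintegral_map' (f := fun w => logMinus (lipSup φ K₀ (B n) r w))
        (continuous_logMinus.measurable.comp (hm n)).aemeasurable hW]
  · filter_upwards [hL.bound] with ω hω n
    have h0 : shift 0 (W ω) = W ω := by ext1 t; simp
    conv_lhs => rw [← h0]
    refine lipSup_shift_le fun θ' hθ' x hx y hy => ?_
    have hθΘ := (hBsub n hθ').2
    have h1 : ‖iter (fun t => φ (W ω t)) r 0 x θ' - iter (fun t => φ (W ω t)) r 0 y θ'‖ₑ ≤
        (L ω ⟨θ', hθΘ⟩ : ℝ≥0∞) * ‖x - y‖ₑ := by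
      have := hω ⟨θ', hθΘ⟩ x (hK₀ hx) y (hK₀ hy)
      rw [Real.enorm_eq_ofReal_abs, Real.enorm_eq_ofReal_abs, ← ENNReal.ofReal_coe_nnreal,
        ← ENNReal.ofReal_mul (NNReal.coe_nonneg _)]
      exact ENNReal.ofReal_le_ofReal this
    refine h1.trans (mul_le_mul_left ?_ _)
    exact le_iSup₂_of_le (⟨θ', hθΘ⟩ : Θ) (hBsub n hθ').1 le_rfl
  · filter_upwards [hL.continuous] with ω hω
    exact tendsto_iSup_ball hω θ
  · filter_upwards [hf] with ω hω
    exact (logPlus_mono (lipSup_le_prod hω hK hK₀ hKK₀ hΘ.isClosed hΘ₀ hΘΘ₀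
      ((hBsub n).trans Set.inter_subset_right) r)).trans (logPlus_prod_le _ _)
  · rw [lintegral_finsetSum' (f := fun (i : ℕ) ω =>
      logPlus (lipSup φ K₀ Θ₀ 1 (shift (-(i : ℤ)) (W ω)))) _ fun i _ => (hm1.comp (measurable_shift _)).comp_aemeasurable hW]
    refine (ENNReal.sum_lt_top.2 fun i _ => ?_).ne
    have : ∫⁻ ω, logPlus (lipSup φ K₀ Θ₀ 1 (shift (-(i : ℤ)) (W ω))) ∂P =
        ∫⁻ ω, logPlus (lipSup φ K₀ Θ₀ 1 (W ω)) ∂P := by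
      rw [← lintegral_map' (f := fun w => logPlus (lipSup φ K₀ Θ₀ 1 (shift (-(i : ℤ)) w)))
        (hm1.comp (measurable_shift _)).aemeasurable hW,
        ← lintegral_map' hm1.aemeasurable hW]
      exact (hμ _).lintegral_comp hm1
    rw [this]
    exact hfin

/-- The compositions of `n` successive maps, up to any time and from time `0` on, contract `K` at
the rate `exp (-ρ n)`, uniformly over `θ ∈ B`. -/
def IsContracting {E : Type*} (K : Set ℝ) (B : Set E) (ρ : ℝ) (f : ℤ → ℝ → E → ℝ) : Prop :=
  (∀ t : ℤ, ∀ᶠ n : ℕ in atTop, ∀ θ ∈ B, ∀ x ∈ K, ∀ y ∈ K,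
    |iter f n (t - 1) x θ - iter f n (t - 1) y θ| ≤ Real.exp (-ρ * n) * |x - y|) ∧
  ∀ᶠ n : ℕ in atTop, ∀ θ ∈ B, ∀ x ∈ K, ∀ y ∈ K,
    |iter f n (n - 1) x θ - iter f n (n - 1) y θ| ≤ Real.exp (-ρ * n) * |x - y|

lemma abs_le_mul_of_enorm_le {u v c : ℝ} {A : ℝ≥0∞} (h : ‖u‖ₑ ≤ A * ‖v‖ₑ)
    (hA : A ≤ ENNReal.ofReal c) (hc : 0 ≤ c) : |u| ≤ c * |v| := by
  have : ENNReal.ofReal |u| ≤ ENNReal.ofReal (c * |v|) := by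
    rw [ENNReal.ofReal_mul hc, ← Real.enorm_eq_ofReal_abs, ← Real.enorm_eq_ofReal_abs]
    exact h.trans (mul_le_mul_left hA _)
  exact (ENNReal.ofReal_le_ofReal_iff (by positivity)).1 this

omit [MetricSpace E] in
lemma eventually_of_eventually_add {p : ℕ → Prop} (r : ℕ) (h : ∀ᶠ n in atTop, p (n + r)) :
    ∀ᶠ n in atTop, p n := by
  obtain ⟨N, hN⟩ := eventually_atTop.1 h
  filter_upwards [eventually_ge_atTop (N + r)] with n hn
  have := hN (n - r) (by omega)
  rwa [Nat.sub_add_cancel (by omega)] at this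

/-- Deterministic criterion for contraction, in terms of the growth of the logarithms `a` and `b` of
the Lipschitz coefficients of the maps and of their `r`-fold compositions. -/
lemma isContracting_of_growth {E : Type*} {K : Set ℝ} {B : Set E} {f : ℤ → ℝ → E → ℝ} {r : ℕ}
    (hr : 1 ≤ r) {a b : ℤ → ℝ} {ε : ℝ} (hε : 0 < ε)
    (hf : ∀ t, ∀ x ∈ K, ∀ θ ∈ B, f t x θ ∈ K) (ha : ∀ t, 0 ≤ a t)
    (h1 : ∀ t, ∀ θ ∈ B, ∀ x ∈ K, ∀ y ∈ K, |f t x θ - f t y θ| ≤ Real.exp (a t) * |x - y|)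
    (h2 : ∀ t, ∀ θ ∈ B, ∀ x ∈ K, ∀ y ∈ K,
      |iter f r t x θ - iter f r t y θ| ≤ Real.exp (b t) * |x - y|)
    (hA : ∀ t : ℤ, (∃ C : ℝ, ∀ n : ℕ, a (t - n) ≤ C + ε / (2 * r ^ 2) * n) ∧
      ∃ C : ℝ, ∀ n : ℕ, a (t + n) ≤ C + ε / (2 * r ^ 2) * n)
    (hb : ∀ t : ℤ, (∃ C : ℝ, ∀ n : ℕ, ∑ i ∈ Finset.range n, b (t - i) ≤ C + -ε * n) ∧
      ∃ C : ℝ, ∀ n : ℕ, ∑ i ∈ Finset.range n, b (t + i) ≤ C + -ε * n) :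
    IsContracting K B (ε / (4 * r)) f := by
  have hr0 : (0 : ℝ) < r := by positivity
  have key : ∀ (s : ℕ → ℤ) (C₁ C₂ : ℝ),
      (∀ n, (∑ i ∈ Finset.range r, a (s n + i)) + ∑ i ∈ Finset.range r, a (s n + n + i) ≤
        C₁ + ε / (2 * r) * n) →
      (∀ n, ∑ i ∈ Finset.range n, b (s n + i + r - 1) ≤ C₂ + -ε * n) →
      ∀ᶠ n : ℕ in atTop, ∀ θ ∈ B, ∀ x ∈ K, ∀ y ∈ K,
        |iter f (n + r) (s n + n + r - 1) x θ - iter f (n + r) (s n + n + r - 1) y θ| ≤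
          Real.exp (-(ε / (4 * r)) * (n + r : ℕ)) * |x - y| := by
    intro s C₁ C₂ hC₁ hC₂
    filter_upwards [eventually_exponent_le hr hε hC₁ hC₂] with n hn θ hθ x hx y hy
    refine (abs_iter_sub_iter_le hr (fun t x hx => hf t x hx θ hθ) ha (fun t => h1 t θ hθ)
      (fun t => h2 t θ hθ) (s n) n hx hy).trans ?_
    refine mul_le_mul_of_nonneg_right (Real.exp_le_exp.2 (le_trans (le_of_eq ?_) hn)) (abs_nonneg _)
    ring
  -- The `r` boundary terms, each of slope `ε / (2r²)`, together have slope `ε / (2r)`, half of the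
  -- gain `ε / r`.
  have hcoef : (r : ℝ) * (ε / (2 * r ^ 2)) = ε / (2 * r) := by field_simp
  have hε' : 0 ≤ ε / (2 * (r : ℝ) ^ 2) := by positivity
  have hfar : ∀ {C : ℝ} {g : ℕ → ℝ} (n : ℕ), (∀ i ∈ Finset.range r,
      g i ≤ C + ε / (2 * r ^ 2) * ((n + r : ℕ) : ℝ)) →
      ∑ i ∈ Finset.range r, g i ≤ (r * C + ε / (2 * r) * r) + ε / (2 * r) * n := by
    intro C g n hg
    refine (Finset.sum_le_card_nsmul _ _ _ hg).trans_eq ?_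
    rw [Finset.card_range, nsmul_eq_mul, mul_add, ← mul_assoc, hcoef]
    push_cast
    ring
  constructor
  · intro t
    obtain ⟨C₁, hC₁⟩ := (hA t).1
    -- With the window starting at `t - n - r`, the `r`-blocks end at the times `t - n - 1, …, t -
    -- 2`, summed downwards from `t - 2`. The first `r` single maps recede into the past; the last
    -- `r` are fixed.
    obtain ⟨C₂, hC₂⟩ := (hb (t - 2)).1
    refine eventually_of_eventually_add r ?_
    have := key (fun n => t - n - r) ((r * C₁ + ε / (2 * r) * r) +
      ∑ i ∈ Finset.range r, a (t - r + i)) C₂ (fun n => ?_) fun n => ?_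
    · filter_upwards [this] with n hn
      have e : t - (n : ℤ) - r + n + r - 1 = t - 1 := by ring
      rwa [e] at hn
    · have e : t - (n : ℤ) - r + n = t - r := by ring
      have := hfar (g := fun i => a (t - n - r + i)) n fun i hi => by
        have hi := Finset.mem_range.1 hi
        have e' : t - (n : ℤ) - r + i = t - ((n + r - i : ℕ) : ℤ) := by omega
        simp only [e']
        refine (hC₁ _).trans (add_le_add le_rfl (mul_le_mul_of_nonneg_left ?_ hε'))
        exact_mod_cast Nat.sub_le _ _
      rw [e]
      linarith
    · rw [← Finset.sum_range_reflect]
      refine (Finset.sum_congr rfl fun i hi => ?_).trans_le (hC₂ n)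
      have hi := Finset.mem_range.1 hi
      congr 1
      omega
  · obtain ⟨C₁, hC₁⟩ := (hA 0).2
    -- The first `r`-block starting at time `0` ends at `r - 1`. Now the initial single maps are
    -- fixed and the final ones move away.
    obtain ⟨C₂, hC₂⟩ := (hb (r - 1)).2
    refine eventually_of_eventually_add r ?_
    have := key (fun n => 0) ((r * C₁ + ε / (2 * r) * r) +
      ∑ i ∈ Finset.range r, a (0 + i)) C₂ (fun n => ?_) fun n => ?_
    · filter_upwards [this] with n hn
      have e : (0 : ℤ) + n + r - 1 = ((n + r : ℕ) : ℤ) - 1 := by push_cast; ring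
      rwa [e] at hn
    · have := hfar (g := fun i => a (0 + n + i)) n fun i hi => by
        have hi := Finset.mem_range.1 hi
        have e' : (0 : ℤ) + n + i = 0 + ((n + i : ℕ) : ℤ) := by push_cast; ring
        simp only [e']
        refine (hC₁ _).trans (add_le_add le_rfl (mul_le_mul_of_nonneg_left ?_ hε'))
        exact_mod_cast (by omega : n + i ≤ n + r)
      linarith
    · refine (Finset.sum_congr rfl fun i hi => ?_).trans_le (hC₂ n)
      congr 1
      ring

/-- Along almost every path, the ergodic theorem supplies the linear decay of the sums of `F`, which
dominates the logarithm of the `r`-fold coefficient, and sublinear growth of the one-step `log⁺`: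
these are the inputs of `isContracting_of_growth`. -/
lemma ae_isContracting_ball (hW : AEMeasurable W P)
    (hμ : ∀ k, MeasurePreserving (shift k) (P.map W) (P.map W))
    (herg : ∀ k : ℤ, k = 1 ∨ k = -1 → Ergodic (shift k) (P.map W))
    (hφ : ∀ θ, Measurable fun p : S × ℝ => φ p.1 p.2 θ)
    (hf : ∀ᵐ ω ∂P, IsContinuousFamily K Θ fun t => φ (W ω t))
    (hK : IsClosed K) (hK₀c : K₀.Countable) (hK₀ : K₀ ⊆ K) (hKK₀ : K ⊆ closure K₀)
    (hΘ : IsCompact Θ) (hΘ₀c : Θ₀.Countable) (hΘ₀ : Θ₀ ⊆ Θ) (hΘΘ₀ : Θ ⊆ closure Θ₀)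
    (hfin : ∫⁻ ω, logPlus (lipSup φ K₀ Θ₀ 1 (W ω)) ∂P < ∞) {r : ℕ} (hr : 1 ≤ r) {B₀ B : Set E}
    (hB₀c : B₀.Countable) (hB₀ : B₀ ⊆ Θ) (hBB₀ : B ⊆ closure B₀) (hB : B ⊆ Θ)
    (hneg : ∫⁻ w, logPlus (lipSup φ K₀ B₀ r w) ∂(P.map W) <
        ∫⁻ w, logMinus (lipSup φ K₀ B₀ r w) ∂(P.map W)) :
    ∃ ρ > 0, ∀ᵐ ω ∂P, IsContracting K B ρ fun t => φ (W ω t) := by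
  have : IsProbabilityMeasure (P.map W) := Measure.isProbabilityMeasure_map hW
  have hm1 : Measurable (lipSup φ K₀ Θ₀ 1) := measurable_lipSup hφ hK₀c hΘ₀c 1
  have hmP : Measurable fun w : ℤ → S => logPlus (lipSup φ K₀ Θ₀ 1 w) :=
    continuous_logPlus.measurable.comp hm1
  have hfin' : ∫⁻ w, logPlus (lipSup φ K₀ Θ₀ 1 w) ∂(P.map W) ≠ ∞ := by
    rw [lintegral_map' hmP.aemeasurable hW]; exact hfin.ne
  obtain ⟨F, hFm, hFi, hFneg, hFle⟩ :=
    exists_integrable_le_exp (measurable_lipSup hφ hK₀c hB₀c r) hneg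
  obtain ⟨ε, hε, hFε⟩ : ∃ ε > 0, ∫ w, F w ∂(P.map W) < -ε :=
    ⟨-(∫ w, F w ∂(P.map W)) / 2, by linarith, by linarith⟩
  have hαm := hmP.ennreal_toReal
  have hαi := integrable_toReal_of_lintegral_ne_top hmP.aemeasurable hfin'
  have hr0 : (0 : ℝ) < r := by positivity
  have hαle : ∀ᵐ w ∂(P.map W), lipSup φ K₀ Θ₀ 1 w ≤
      ENNReal.ofReal (Real.exp (logPlus (lipSup φ K₀ Θ₀ 1 w)).toReal) := by
    filter_upwards [ae_lt_top hmP hfin'] with w hw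
    simpa using le_ofReal_exp_logPlus (fun hx => hw.ne (logPlus_eq_top_iff.2 hx)) zero_le
  refine ⟨ε / (4 * r), by positivity, ?_⟩
  filter_upwards [hf, ae_of_ae_map hW (ae_exists_sum_shift_le hμ herg hFm hFi hFε),
    ae_of_ae_map hW (ae_exists_shift_le hμ herg hαm hαi
      (show 0 < ε / (2 * (r : ℝ) ^ 2) by positivity)),
    ae_of_ae_map hW (ae_forall_shift hμ hFle), ae_of_ae_map hW (ae_forall_shift hμ hαle)]
    with ω hω hS hA hF1 hα1
  refine isContracting_of_growth (a := fun t => (logPlus (lipSup φ K₀ Θ₀ 1 (shift t (W ω)))).toReal)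
    (b := fun t => F (shift t (W ω))) hr hε (fun t x hx θ hθ => hω.mem t x hx θ (hB hθ))
    (fun t => ENNReal.toReal_nonneg) (fun t θ hθ x hx y hy => ?_) (fun t θ hθ x hx y hy => ?_) hA hS
  · exact abs_le_mul_of_enorm_le (enorm_iter_sub_le_lipSup_of_subset_closure hω hK hK₀ hKK₀
      hΘ.isClosed hΘ₀ 1 t (hΘΘ₀ (hB hθ)) hx hy) (hα1 t) (Real.exp_pos _).le
  · exact abs_le_mul_of_enorm_le (enorm_iter_sub_le_lipSup_of_subset_closure hω hK hK₀ hKK₀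
      hΘ.isClosed hB₀ r t (hBB₀ hθ) hx hy) (hF1 t) (Real.exp_pos _).le

end Contraction

/-! ### Uniformity over the compact parameter set -/

section Uniform

variable {Ω S E : Type*} [MeasurableSpace Ω] [MeasurableSpace S] [MetricSpace E]
  {P : Measure Ω} {W : Ω → ℤ → S} {φ : S → ℝ → E → ℝ}
  {K K₀ : Set ℝ} {Θ Θ₀ : Set E}

omit [MeasurableSpace S] in
-- Continuity in `θ` for fixed `x` becomes joint continuity because the Lipschitz bounds in `x` are
-- themselves bounded on the compact `Θ`.
lemma IsRegular.ae_isContinuousFamily {f : ℤ → Ω → ℝ → E → ℝ} (hf : IsRegular P K Θ f)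
    (hΘ : IsCompact Θ) {L : ℤ → Ω → Θ → ℝ≥0} (hL : ∀ t, IsLipschitzBound P K Θ (f t) (L t)) :
    ∀ᵐ ω ∂P, IsContinuousFamily K Θ fun t => f t ω := by
  have : CompactSpace Θ := isCompact_iff_compactSpace.1 hΘ
  filter_upwards [ae_all_iff.2 hf, ae_all_iff.2 fun t => (hL t).continuous,
    ae_all_iff.2 fun t => (hL t).bound] with ω h1 h2 h3
  refine ⟨fun t x hx θ hθ => (h1 t).1 x hx θ hθ, fun t => ?_⟩
  obtain ⟨C, hC⟩ := (isCompact_range (h2 t)).bddAbove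
  refine continuousOn_prod_of_continuousOn_lipschitzOnWith _ C (h1 t).2 fun θ hθ => ?_
  refine LipschitzOnWith.of_dist_le_mul fun x hx y hy => ?_
  rw [Real.dist_eq, Real.dist_eq]
  refine (h3 t ⟨θ, hθ⟩ x hx y hy).trans (mul_le_mul_of_nonneg_right ?_ (abs_nonneg _))
  exact_mod_cast hC (Set.mem_range_self (⟨θ, hθ⟩ : Θ))

omit [MeasurableSpace S] in
lemma lintegral_logPlus_lipSup_lt_top (hK₀ : K₀ ⊆ K) (hΘ₀ : Θ₀ ⊆ Θ) {L : Ω → Θ → ℝ≥0}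
    (hL : IsLipschitzBound P K Θ (fun ω => φ (W ω 0)) L)
    (hfin : ∫⁻ ω, logPlus (supNorm fun θ : Θ => (L ω θ : ℝ)) ∂P < ∞) :
    ∫⁻ ω, logPlus (lipSup φ K₀ Θ₀ 1 (W ω)) ∂P < ∞ := by
  refine (lintegral_mono_ae ?_).trans_lt hfin
  filter_upwards [hL.bound] with ω hω
  refine logPlus_mono ?_
  have h0 : shift 0 (W ω) = W ω := by ext1 t; simp
  conv_lhs => rw [← h0]
  refine lipSup_shift_le fun θ hθ x hx y hy => ?_
  have h1 : ‖(L ω ⟨θ, hΘ₀ hθ⟩ : ℝ)‖ₑ ≤ supNorm fun θ : Θ => (L ω θ : ℝ) :=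
    le_iSup (fun θ : Θ => ‖(L ω θ : ℝ)‖ₑ) ⟨θ, hΘ₀ hθ⟩
  refine le_trans ?_ (mul_le_mul_left h1 _)
  rw [← enorm_mul, enorm_le_iff_norm_le, norm_mul, Real.norm_eq_abs, Real.norm_eq_abs,
    Real.norm_eq_abs, abs_of_nonneg (NNReal.coe_nonneg _)]
  exact hω ⟨θ, hΘ₀ hθ⟩ x (hK₀ hx) y (hK₀ hy)

omit [MetricSpace E] in
lemma IsContracting.mono {B B' : Set E} {ρ ρ' : ℝ} {f : ℤ → ℝ → E → ℝ}
    (h : IsContracting K B ρ f) (hB : B' ⊆ B) (hρ : ρ' ≤ ρ) : IsContracting K B' ρ' f := by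
  have hexp : ∀ n : ℕ, Real.exp (-ρ * n) ≤ Real.exp (-ρ' * n) := fun n =>
    Real.exp_le_exp.2 (mul_le_mul_of_nonneg_right (neg_le_neg hρ) (Nat.cast_nonneg n))
  constructor
  · intro t
    filter_upwards [h.1 t] with n hn θ hθ x hx y hy
    exact (hn θ (hB hθ) x hx y hy).trans (mul_le_mul_of_nonneg_right (hexp n) (abs_nonneg _))
  · filter_upwards [h.2] with n hn θ hθ x hx y hy
    exact (hn θ (hB hθ) x hx y hy).trans (mul_le_mul_of_nonneg_right (hexp n) (abs_nonneg _))

omit [MetricSpace E] in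
lemma IsContracting.union {B B' : Set E} {ρ : ℝ} {f : ℤ → ℝ → E → ℝ}
    (h : IsContracting K B ρ f) (h' : IsContracting K B' ρ f) : IsContracting K (B ∪ B') ρ f := by
  constructor
  · intro t
    filter_upwards [h.1 t, h'.1 t] with n hn hn' θ hθ
    exact hθ.elim (hn θ) (hn' θ)
  · filter_upwards [h.2, h'.2] with n hn hn' θ hθ
    exact hθ.elim (hn θ) (hn' θ)

/-- Condition (CI) makes the maps contract uniformly over the compact set `Θ`. -/
lemma exists_ae_isContracting [IsProbabilityMeasure P] (hW : AEMeasurable W P)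
    (hμ : ∀ k, MeasurePreserving (shift k) (P.map W) (P.map W))
    (herg : ∀ k : ℤ, k = 1 ∨ k = -1 → Ergodic (shift k) (P.map W))
    (hφ : ∀ θ, Measurable fun p : S × ℝ => φ p.1 p.2 θ)
    (hK : IsClosed K) (hΘ : IsCompact Θ) (hreg : IsRegular P K Θ fun t ω => φ (W ω t))
    (hCI : CI P K Θ fun t ω => φ (W ω t)) :
    ∃ ρ > 0, ∀ᵐ ω ∂P, IsContracting K Θ ρ fun t => φ (W ω t) := by
  obtain ⟨L, hL, hLfin⟩ := hCI.lipMoment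
  have hf := hreg.ae_isContinuousFamily hΘ hL
  obtain ⟨K₀, hK₀, hK₀c, hKK₀⟩ :=
    (TopologicalSpace.IsSeparable.of_separableSpace K).exists_countable_dense_subset
  obtain ⟨Θ₀, hΘ₀, hΘ₀c, hΘΘ₀⟩ := hΘ.isSeparable.exists_countable_dense_subset
  have hfin := lintegral_logPlus_lipSup_lt_top (φ := φ) (W := W) hK₀ hΘ₀ (hL 0) hLfin
  -- Contraction at some positive rate passes to subsets and, with the smaller rate, to unions; so
  -- it is enough to have it near each point.
  refine (hΘ.induction_on
    (p := fun B => ∃ ρ > 0, ∀ᵐ ω ∂P, IsContracting K (B ∩ Θ) ρ fun t => φ (W ω t)) ?_ ?_ ?_ ?_).imp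
    fun ρ h => by rwa [Set.inter_self] at h
  · exact ⟨1, one_pos, Eventually.of_forall fun ω => ⟨fun t => by simp, by simp⟩⟩
  · rintro B B' hBB' ⟨ρ, hρ, h⟩
    exact ⟨ρ, hρ, h.mono fun ω hω => hω.mono (Set.inter_subset_inter_left _ hBB') le_rfl⟩
  · rintro B B' ⟨ρ, hρ, h⟩ ⟨ρ', hρ', h'⟩
    refine ⟨min ρ ρ', lt_min hρ hρ', ?_⟩
    filter_upwards [h, h'] with ω h1 h2
    rw [Set.union_inter_distrib_right]
    exact (h1.mono le_rfl (min_le_left _ _)).union (h2.mono le_rfl (min_le_right _ _))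
  · intro θ hθ
    obtain ⟨r, hr, L', hL', hneg⟩ := hCI.lyapunov ⟨θ, hθ⟩
    obtain ⟨δ, hδ, B₀, hB₀c, hB₀, hBB₀, hlt⟩ := exists_ball_lyapunov hW hμ hφ hf hK hK₀c hK₀ hKK₀
      hΘ hΘ₀c hΘ₀ hΘΘ₀ hfin ⟨θ, hθ⟩ r L' hL' hneg
    exact ⟨_, mem_nhdsWithin_of_mem_nhds (Metric.ball_mem_nhds θ hδ),
      ae_isContracting_ball hW hμ herg hφ hf hK hK₀c hK₀ hKK₀ hΘ hΘ₀c hΘ₀ hΘΘ₀ hfin hr hB₀c hB₀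
        hBB₀ Set.inter_subset_right hlt⟩

/-- The values of the maps at a point grow subexponentially. -/
lemma ae_exists_abs_le_exp [IsProbabilityMeasure P] (hW : AEMeasurable W P)
    (hμ : ∀ k, MeasurePreserving (shift k) (P.map W) (P.map W))
    (herg : ∀ k : ℤ, k = 1 ∨ k = -1 → Ergodic (shift k) (P.map W))
    (hφ : ∀ θ, Measurable fun p : S × ℝ => φ p.1 p.2 θ) (hΘ : IsCompact Θ)
    (hreg : IsRegular P K Θ fun t ω => φ (W ω t)) {y : ℝ} (hy : y ∈ K)
    (hfin : ∫⁻ ω, logPlus (supNorm fun θ : Θ => φ (W ω 0) y θ) ∂P < ∞) {ε : ℝ} (hε : 0 < ε) :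
    ∀ᵐ ω ∂P, ∀ t : ℤ, ∃ C : ℝ, ∀ n : ℕ, ∀ θ ∈ Θ,
      |φ (W ω (t - n)) y θ| ≤ Real.exp (C + ε * n) := by
  have : IsProbabilityMeasure (P.map W) := Measure.isProbabilityMeasure_map hW
  obtain ⟨Θ₀, hΘ₀, hΘ₀c, hΘΘ₀⟩ := hΘ.isSeparable.exists_countable_dense_subset
  let G : (ℤ → S) → ℝ≥0∞ := fun w => ⨆ θ ∈ Θ₀, ‖φ (w 0) y θ‖ₑ
  have hpair : Measurable fun w : ℤ → S => (w 0, y) :=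
    (measurable_pi_apply 0).prodMk measurable_const
  have hφ0 : ∀ θ, Measurable fun w : ℤ → S => φ (w 0) y θ := fun θ => (hφ θ).comp hpair
  have hG : Measurable G := .biSup _ hΘ₀c fun θ _ => (hφ0 θ).enorm
  have hmP : Measurable fun w => logPlus (G w) := continuous_logPlus.measurable.comp hG
  have hGfin : ∫⁻ w, logPlus (G w) ∂(P.map W) ≠ ∞ := by
    rw [lintegral_map' hmP.aemeasurable hW]
    refine ((lintegral_mono fun ω => logPlus_mono ?_).trans_lt hfin).ne
    exact iSup₂_le fun θ hθ => le_iSup (fun θ : Θ => ‖φ (W ω 0) y θ‖ₑ) ⟨θ, hΘ₀ hθ⟩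
  have hle : ∀ᵐ w ∂(P.map W), G w ≤ ENNReal.ofReal (Real.exp (logPlus (G w)).toReal) := by
    filter_upwards [ae_lt_top hmP hGfin] with w hw
    simpa using le_ofReal_exp_logPlus (fun hx => hw.ne (logPlus_eq_top_iff.2 hx)) zero_le
  filter_upwards [ae_all_iff.2 hreg, ae_of_ae_map hW (ae_forall_shift hμ hle),
    ae_of_ae_map hW (ae_exists_shift_le hμ herg hmP.ennreal_toReal
      (integrable_toReal_of_lintegral_ne_top hmP.aemeasurable hGfin) hε)] with ω h1 h2 h3 t
  obtain ⟨C, hC⟩ := (h3 t).1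
  refine ⟨C, fun n θ hθ => ?_⟩
  have hcl : closure Θ₀ ⊆ Θ := closure_minimal hΘ₀ hΘ.isClosed
  refine le_on_closure (s := Θ₀) (f := fun θ => |φ (W ω (t - n)) y θ|)
    (g := fun _ => Real.exp (C + ε * n)) (fun θ hθ => ?_)
    (continuous_abs.comp_continuousOn (((h1 (t - n)).2 y hy).mono hcl)) continuousOn_const
    (hΘΘ₀ hθ)
  have e : ‖φ (W ω (t - n)) y θ‖ₑ ≤ G (shift (t - n) (W ω)) := by
    simp only [G, shift_apply, zero_add]
    exact le_iSup₂_of_le θ hθ le_rfl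
  have := e.trans (h2 (t - n))
  rw [Real.enorm_eq_ofReal_abs, ENNReal.ofReal_le_ofReal_iff (Real.exp_pos _).le] at this
  exact this.trans (Real.exp_le_exp.2 (hC n))

end Uniform

/-! ### The limit of the backward iterates -/

section Limit

variable {E : Type*} [MetricSpace E] {K : Set ℝ} {Θ : Set E} {f : ℤ → ℝ → E → ℝ}

/-- The backward iterates started at `y` converge to a continuous function of `θ ∈ Θ`. -/
lemma exists_tendsto_iter (hf : IsContinuousFamily K Θ f) (hK : IsClosed K) (hΘ : IsCompact Θ)
    {ρ : ℝ} (hρ : 0 < ρ) (hc : IsContracting K Θ ρ f) {y : ℝ} (hy : y ∈ K) (t : ℤ)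
    (hgrow : ∃ C : ℝ, ∀ n : ℕ, ∀ θ ∈ Θ, |f (t - n) y θ| ≤ Real.exp (C + ρ / 2 * n)) :
    ∃ G : C(Θ, K), ∀ θ : Θ, Tendsto (fun n : ℕ => iter f n (t - 1) y θ) atTop (𝓝 (G θ)) := by
  have : CompactSpace Θ := isCompact_iff_compactSpace.1 hΘ
  have : CompleteSpace K := hK.completeSpace_coe
  let u : ℕ → C(Θ, K) := fun n => ⟨fun θ => ⟨iter f n (t - 1) y θ,
    iter_mem (fun t x hx => hf.mem t x hx _ θ.2) n _ hy⟩, by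
      refine Continuous.subtype_mk ?_ _
      exact (hf.continuousOn_iter n (t - 1)).comp_continuous
        (continuous_const.prodMk continuous_subtype_val) fun θ => ⟨hy, θ.2⟩⟩
  obtain ⟨C, hC⟩ := hgrow
  obtain ⟨N, hN⟩ := eventually_atTop.1 (hc.1 t)
  -- The two iterates apply the same `n` maps to `y` and to `f (t - 1 - n) y θ`; contraction at rate
  -- `ρ` against growth at rate `ρ / 2` leaves a geometric bound of rate `ρ / 2`.
  have hdist : ∀ n ≥ N, dist (u n) (u (n + 1)) ≤
      (Real.exp (C + ρ / 2) + |y|) * Real.exp (-(ρ / 2)) ^ n := by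
    intro n hn
    rw [ContinuousMap.dist_le (by positivity)]
    intro θ
    have h1 := hN n hn θ θ.2 y hy (f (t - 1 - n) y θ) (hf.mem _ y hy θ θ.2)
    have e : iter f (n + 1) (t - 1) y θ = iter f n (t - 1) (f (t - 1 - n) y θ) θ := by
      rw [iter_add]; rfl
    change dist (iter f n (t - 1) y θ) (iter f (n + 1) (t - 1) y θ) ≤ _
    rw [Real.dist_eq, e]
    refine h1.trans ?_
    have h2 := hC (n + 1) θ θ.2
    have e2 : t - ((n + 1 : ℕ) : ℤ) = t - 1 - n := by push_cast; ring
    rw [e2] at h2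
    have e3 : Real.exp (C + ρ / 2 * ((n + 1 : ℕ) : ℝ)) =
        Real.exp (C + ρ / 2) * Real.exp (ρ / 2 * n) := by
      rw [← Real.exp_add]; congr 1; push_cast; ring
    have h3 : 1 ≤ Real.exp (ρ / 2 * n) := Real.one_le_exp (by positivity)
    have h4 : |y - f (t - 1 - n) y θ| ≤ (Real.exp (C + ρ / 2) + |y|) * Real.exp (ρ / 2 * n) := by
      rw [add_mul, ← e3, add_comm]
      refine (abs_sub _ _).trans (add_le_add ?_ h2)
      exact le_mul_of_one_le_right (abs_nonneg _) h3
    have e4 : Real.exp (-(ρ / 2)) ^ n = Real.exp (-ρ * n) * Real.exp (ρ / 2 * n) := by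
      rw [← Real.exp_nat_mul, ← Real.exp_add]; congr 1; ring
    rw [e4, mul_left_comm]
    exact mul_le_mul_of_nonneg_left h4 (Real.exp_pos _).le
  have hcauchy : CauchySeq fun n => u (n + N) := by
    refine cauchySeq_of_le_geometric (Real.exp (-(ρ / 2)))
      ((Real.exp (C + ρ / 2) + |y|) * Real.exp (-(ρ / 2)) ^ N)
      (by rw [Real.exp_lt_one_iff]; linarith) fun n => ?_
    have := hdist (n + N) (by omega)
    rw [pow_add, mul_comm (Real.exp (-(ρ / 2)) ^ n), ← mul_assoc] at this
    convert this using 3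
    ring
  obtain ⟨G, hG⟩ := cauchySeq_tendsto_of_complete hcauchy
  rw [tendsto_add_atTop_iff_nat] at hG
  refine ⟨G, fun θ => ?_⟩
  exact (continuous_subtype_val.tendsto _).comp
    (((continuous_eval_const θ).tendsto G).comp hG)

/-- The limits of the backward iterates solve the recursion. -/
lemma eq_of_tendsto_iter (hf : IsContinuousFamily K Θ f) {y : ℝ} (hy : y ∈ K) {t : ℤ}
    {g g' : ℝ} (hg : g ∈ K) {θ : E} (hθ : θ ∈ Θ)
    (h : Tendsto (fun n : ℕ => iter f n (t - 1) y θ) atTop (𝓝 g))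
    (h' : Tendsto (fun n : ℕ => iter f n t y θ) atTop (𝓝 g')) : g' = f t g θ := by
  have hcont : ContinuousWithinAt (fun x => f t x θ) K g :=
    ((hf.continuousOn t).comp (continuous_id.prodMk continuous_const).continuousOn
      fun x hx => (⟨hx, hθ⟩ : (x, θ) ∈ K ×ˢ Θ)) g hg
  have h1 : Tendsto (fun n : ℕ => iter f (n + 1) t y θ) atTop (𝓝 (f t g θ)) :=
    hcont.tendsto.comp (tendsto_nhdsWithin_iff.2 ⟨h, Eventually.of_forall fun n =>
      iter_mem (fun t x hx => hf.mem t x hx _ hθ) n _ hy⟩)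
  exact tendsto_nhds_unique ((tendsto_add_atTop_iff_nat 1).2 h') h1

omit [MetricSpace E] in
lemma eq_iter_of_sre {g : ℤ → ℝ} {θ : E} (h : ∀ t, g (t + 1) = f t (g t) θ) (n : ℕ) (t : ℤ) :
    g t = iter f n (t - 1) (g (t - n)) θ := by
  induction n generalizing t with
  | zero => simp [iter]
  | succ n ih =>
    have e : t - ((n + 1 : ℕ) : ℤ) = t - 1 - n := by push_cast; ring
    simp only [iter, e]
    rw [← ih (t - 1), ← h (t - 1), sub_add_cancel]

end Limit

/-! ### Stationarity, uniqueness and the exponential rate -/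

section Final

lemma tendsto_measure_abs_gt {Ω : Type*} [MeasurableSpace Ω] {P : Measure Ω} [IsFiniteMeasure P]
    {X : Ω → ℝ} (hX : AEMeasurable X P) :
    Tendsto (fun M : ℕ => P {ω | (M : ℝ) < |X ω|}) atTop (𝓝 0) := by
  have hempty : ⋂ M : ℕ, {ω | (M : ℝ) < |X ω|} = ∅ := by
    ext ω
    simp only [Set.mem_iInter, Set.mem_ofPred_eq, Set.mem_empty_iff_false, iff_false, not_forall,
      not_lt]
    exact exists_nat_ge _
  have := tendsto_measure_iInter_atTop (μ := P) (s := fun M : ℕ => {ω | (M : ℝ) < |X ω|})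
    (fun M => nullMeasurableSet_lt aemeasurable_const hX.abs)
    (fun m n hmn ω (hω : (n : ℝ) < |X ω|) => lt_of_le_of_lt (by exact_mod_cast hmn) hω)
    ⟨0, measure_ne_top _ _⟩
  rwa [hempty, measure_empty] at this

/-- Two sequences of identically distributed random variables are almost surely both bounded along
a common subsequence. -/
lemma ae_exists_frequently_abs_le {Ω : Type*} [MeasurableSpace Ω] {P : Measure Ω}
    [IsFiniteMeasure P] {U V : ℕ → Ω → ℝ} {X Y : Ω → ℝ} (hU : ∀ n, IdentDistrib (U n) X P P)
    (hV : ∀ n, IdentDistrib (V n) Y P P) :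
    ∀ᵐ ω ∂P, ∃ M : ℝ, ∃ᶠ n in atTop, |U n ω| ≤ M ∧ |V n ω| ≤ M := by
  have hX := tendsto_measure_abs_gt (hU 0).aemeasurable_snd
  have hY := tendsto_measure_abs_gt (hV 0).aemeasurable_snd
  rw [ae_iff]
  refine le_antisymm (ge_of_tendsto' (by simpa using hX.add hY) fun M => ?_) zero_le
  -- Off the good event, for each `M` one of the two sequences exceeds `M` at all late times. These
  -- events increase in `N`, with probabilities at most the sum of two tails that do not depend on
  -- `N`.
  have hsub : {ω | ¬∃ M : ℝ, ∃ᶠ n in atTop, |U n ω| ≤ M ∧ |V n ω| ≤ M} ⊆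
      ⋃ N : ℕ, {ω | ∀ n ≥ N, (M : ℝ) < |U n ω| ∨ (M : ℝ) < |V n ω|} := by
    intro ω hω
    simp only [Set.mem_ofPred_eq, not_exists, not_frequently, not_and_or, not_le] at hω
    exact Set.mem_iUnion.2 (eventually_atTop.1 (hω M))
  refine (measure_mono hsub).trans ?_
  have hmono : Monotone fun N : ℕ => {ω | ∀ n ≥ N, (M : ℝ) < |U n ω| ∨ (M : ℝ) < |V n ω|} :=
    fun m n hmn ω hω k hk => hω k (hmn.trans hk)
  rw [hmono.measure_iUnion]
  refine iSup_le fun N => ?_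
  have hms : MeasurableSet {x : ℝ | (M : ℝ) < |x|} :=
    measurableSet_lt measurable_const measurable_id.abs
  have e1 : P {ω | (M : ℝ) < |U N ω|} = P {ω | (M : ℝ) < |X ω|} := (hU N).measure_preimage_eq hms
  have e2 : P {ω | (M : ℝ) < |V N ω|} = P {ω | (M : ℝ) < |Y ω|} := (hV N).measure_preimage_eq hms
  rw [← e1, ← e2]
  refine (measure_mono fun ω hω => ?_).trans (measure_union_le _ _)
  simp only [Set.mem_ofPred_eq] at hω
  exact hω N le_rfl

/-- A space of continuous functions with values in a closed set of real numbers is measurably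
determined by the values at countably many points. -/
lemma exists_measurable_of_eval {Θ : Type*} [MetricSpace Θ] [CompactSpace Θ] {K : Set ℝ}
    (hK : IsClosed K) (hne : Nonempty C(Θ, K)) :
    ∃ D : Set Θ, D.Countable ∧ ∃ e : (D → ℝ) → C(Θ, K), Measurable e ∧
      ∀ G : C(Θ, K), e (fun d => G d) = G := by
  have : CompleteSpace K := hK.completeSpace_coe
  obtain ⟨D, hDc, hD⟩ := TopologicalSpace.exists_countable_dense Θ
  have : Countable D := hDc.to_subtype
  have hm : Measurable fun (G : C(Θ, K)) (d : D) => (G d : ℝ) :=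
    measurable_pi_lambda _ fun d =>
      (continuous_subtype_val.comp (continuous_eval_const (d : Θ))).measurable
  have hinj : Function.Injective fun (G : C(Θ, K)) (d : D) => (G d : ℝ) := by
    intro G H hGH
    refine ContinuousMap.coe_injective (Continuous.ext_on hD G.continuous H.continuous ?_)
    exact fun d hd => Subtype.ext (congrFun hGH ⟨d, hd⟩)
  -- Lusin–Souslin: an injective measurable map out of this Polish space is a measurable embedding,
  -- hence has a measurable left inverse.
  obtain ⟨e, he, hcomp⟩ := (hm.measurableEmbedding hinj).exists_measurable_extend measurable_id
    fun _ => hne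
  exact ⟨D, hDc, e, he, fun G => congrFun hcomp G⟩

variable {Ω S E : Type*} [MeasurableSpace Ω] [MeasurableSpace S] [MetricSpace E]
  {P : Measure Ω} {W : Ω → ℤ → S} {φ : S → ℝ → E → ℝ}
  {K : Set ℝ} {Θ : Set E}

/-- Limits of the backward iterates of a stationary sequence of random maps are stationary. -/
lemma isStationary_of_tendsto_iter (hW : AEMeasurable W P)
    (hμ : ∀ k, MeasurePreserving (shift k) (P.map W) (P.map W))
    (hφ : ∀ θ, Measurable fun p : S × ℝ => φ p.1 p.2 θ) (hK : IsClosed K) (hΘ : IsCompact Θ)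
    {y : ℝ} {g : ℤ → Ω → C(Θ, K)} (hne : Nonempty C(Θ, K))
    (hg : ∀ᵐ ω ∂P, ∀ (t : ℤ) (θ : Θ), Tendsto
      (fun n : ℕ => iter (fun u => φ (W ω u)) n (t - 1) y θ) atTop (𝓝 (g t ω θ))) :
    IsStationary P g := by
  have : CompactSpace Θ := isCompact_iff_compactSpace.1 hΘ
  obtain ⟨D, hDc, e, he, heG⟩ := exists_measurable_of_eval (Θ := Θ) hK hne
  -- A measurable, shift equivariant version of `g` as a function of the path: stationarity of the
  -- path transfers through it.
  let Ψ : (ℤ → S) → ℤ → C(Θ, K) := fun w t =>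
    e fun d => limUnder atTop fun n : ℕ => iter (fun u => φ (w u)) n (t - 1) y (d : Θ)
  have hΨ : Measurable Ψ := measurable_pi_lambda _ fun t => he.comp <| measurable_pi_lambda _
    fun d => (StronglyMeasurable.limUnder fun n =>
      ((measurable_iter (hφ (d : Θ)) n (t - 1)).comp
        (measurable_id.prodMk measurable_const)).stronglyMeasurable).measurable
  have hΨg : ∀ᵐ ω ∂P, ∀ t, Ψ (W ω) t = g t ω := by
    filter_upwards [hg] with ω hω t
    rw [← heG (g t ω)]
    exact congrArg e (funext fun d => (hω t d).limUnder_eq)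
  have hshift : ∀ (k : ℤ) (w : ℤ → S) (t : ℤ), Ψ (shift k w) t = Ψ w (t + k) := by
    intro k w t
    have h1 := fun n => iter_shift (fun u => φ (w u)) k n (t - 1)
    have h2 : t - 1 + k = t + k - 1 := by ring
    simp only [Ψ, shift_apply, h1, h2]
  intro k
  have hid : IdentDistrib (fun ω => shift k (W ω)) W P P :=
    ⟨(measurable_shift k).comp_aemeasurable hW, hW,
      (AEMeasurable.map_map_of_aemeasurable (measurable_shift k).aemeasurable hW).symm.trans
        (hμ k).map_eq⟩
  have h1 : IdentDistrib (fun ω => Ψ (shift k (W ω))) (fun ω (t : ℤ) => g (t + k) ω) P P := by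
    refine IdentDistrib.of_ae_eq (hΨ.comp_aemeasurable hid.aemeasurable_fst) ?_
    filter_upwards [hΨg] with ω hω
    funext t
    rw [hshift, hω]
  have h2 : IdentDistrib (fun ω => Ψ (W ω)) (fun ω (t : ℤ) => g t ω) P P := by
    refine IdentDistrib.of_ae_eq (hΨ.comp_aemeasurable hW) ?_
    filter_upwards [hΨg] with ω hω
    funext t
    rw [hω]
  exact h1.symm.trans ((hid.comp hΨ).trans h2)

omit [MeasurableSpace Ω] [MeasurableSpace S] in
lemma approx_eq_iter (f : ℤ → Ω → ℝ → E → ℝ) (g₀ : Ω → C(Θ, K)) (n : ℕ) (ω : Ω) (θ : Θ) :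
    approx f g₀ n ω θ = iter (fun t => f t ω) n (n - 1) (g₀ ω θ) θ := by
  induction n with
  | zero => rfl
  | succ n ih =>
    have e : ((n + 1 : ℕ) : ℤ) - 1 = n := by push_cast; ring
    simp only [approx, iter, ih, e]

omit [MeasurableSpace S] in
-- Both values at `t` are images of those at `t - n` under the same contracting composition. No
-- moment of `y` is assumed, but boundedness along a common sequence of past times is enough.
lemma isUniqueAtEachPoint_of_isContracting [IsFiniteMeasure P] {f : ℤ → Ω → ℝ → E → ℝ}
    {g : ℤ → Ω → C(Θ, K)} {ρ : ℝ} (hρ : 0 < ρ)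
    (hc : ∀ᵐ ω ∂P, IsContracting K Θ ρ fun t => f t ω) (hg : IsStationarySolution P f g) :
    IsUniqueAtEachPoint P f g := by
  intro θ y hy hyK hys t
  have hU : ∀ n : ℕ, IdentDistrib (y (t - n)) (y t) P P := fun n => by
    have := (hy (-n)).comp (measurable_pi_apply t)
    simpa [Function.comp_def, ← sub_eq_add_neg] using this
  have hV : ∀ n : ℕ, IdentDistrib (fun ω => (g (t - n) ω θ : ℝ)) (fun ω => (g t ω θ : ℝ)) P P :=
    fun n => by
      have hm : Measurable fun G : ℤ → C(Θ, K) => (G t θ : ℝ) :=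
        (continuous_subtype_val.comp (continuous_eval_const θ)).measurable.comp
          (measurable_pi_apply t)
      have := (hg.stationary (-n)).comp hm
      simpa [Function.comp_def, ← sub_eq_add_neg] using this
  filter_upwards [hc, hg.sre, ae_all_iff.2 hyK, ae_all_iff.2 hys,
    ae_exists_frequently_abs_le hU hV] with ω h1 h2 h3 h4 ⟨M, hM⟩
  have hlim : Tendsto (fun n : ℕ => Real.exp (-ρ * n) * (M + M)) atTop (𝓝 0) := by
    have : Tendsto (fun n : ℕ => Real.exp (-ρ * n)) atTop (𝓝 0) := by
      refine Real.tendsto_exp_atBot.comp ?_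
      simp only [neg_mul]
      exact tendsto_neg_atBot_iff.2 (tendsto_natCast_atTop_atTop.const_mul_atTop hρ)
    simpa using this.mul_const (M + M)
  have hle : |y t ω - g t ω θ| ≤ 0 := by
    refine le_of_forall_pos_le_add fun ε hε => ?_
    obtain ⟨n, ⟨hn1, hn2⟩, hn3, hn4⟩ := (hM.and_eventually
      ((h1.1 t).and (hlim.eventually (gt_mem_nhds hε)))).exists
    rw [eq_iter_of_sre (f := fun t => f t ω) (g := fun t => y t ω) (θ := (θ : E)) h4 n t,
      eq_iter_of_sre (f := fun t => f t ω) (g := fun t => (g t ω θ : ℝ)) (θ := (θ : E))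
        (fun t => h2 t θ) n t]
    refine (hn3 θ θ.2 _ (h3 _) _ (g (t - n) ω θ).2).trans ?_
    rw [zero_add]
    refine le_trans (mul_le_mul_of_nonneg_left ?_ (Real.exp_pos _).le) hn4.le
    exact (abs_sub _ _).trans (add_le_add hn1 hn2)
  exact sub_eq_zero.1 (abs_nonpos_iff.1 hle)

omit [MeasurableSpace S] in
-- Both processes arise from time `0` by the same compositions, and the initial distance is finite
-- as `Θ` is compact. Half of the rate `ρ` is kept for the convergence to zero.
lemma tendstoZeroEAS_approxError [CompactSpace Θ] {f : ℤ → Ω → ℝ → E → ℝ}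
    {g : ℤ → Ω → C(Θ, K)} {ρ : ℝ} (hρ : 0 < ρ)
    (hc : ∀ᵐ ω ∂P, IsContracting K Θ ρ fun t => f t ω) (hg : IsStationarySolution P f g)
    (g₀ : Ω → C(Θ, K)) : TendstoZeroEAS P (approxError f g g₀) := by
  refine ⟨fun _ => ρ / 2, measurable_const, fun _ => half_pos hρ, ?_⟩
  filter_upwards [hc, hg.sre] with ω h1 h2
  have hlim : Tendsto (fun n : ℕ => ENNReal.ofReal (Real.exp (-(ρ / 2) * n) *
      dist (g₀ ω) (g 0 ω))) atTop (𝓝 0) := by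
    have : Tendsto (fun n : ℕ => Real.exp (-(ρ / 2) * n)) atTop (𝓝 0) := by
      refine Real.tendsto_exp_atBot.comp ?_
      simp only [neg_mul]
      exact tendsto_neg_atBot_iff.2 (tendsto_natCast_atTop_atTop.const_mul_atTop (half_pos hρ))
    simpa using ENNReal.tendsto_ofReal (this.mul_const (dist (g₀ ω) (g 0 ω)))
  refine tendsto_of_tendsto_of_tendsto_of_le_of_le' tendsto_const_nhds hlim
    (Eventually.of_forall fun _ => zero_le) ?_
  filter_upwards [h1.2] with n hn
  have herr : approxError f g g₀ n ω ≤
      ENNReal.ofReal (Real.exp (-ρ * n) * dist (g₀ ω) (g 0 ω)) := by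
    refine iSup_le fun θ => ?_
    simp only [Real.enorm_eq_ofReal_abs, approx_eq_iter]
    refine ENNReal.ofReal_le_ofReal ?_
    have e := eq_iter_of_sre (f := fun t => f t ω) (g := fun t => (g t ω θ : ℝ)) (θ := (θ : E))
      (fun t => h2 t θ) n n
    simp only [sub_self] at e
    rw [e]
    refine (hn θ θ.2 _ (g₀ ω θ).2 _ (g 0 ω θ).2).trans
      (mul_le_mul_of_nonneg_left ?_ (Real.exp_pos _).le)
    exact ContinuousMap.dist_apply_le_dist (f := g₀ ω) (g := g 0 ω) θ
  refine (mul_le_mul_right herr _).trans_eq ?_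
  rw [← ENNReal.ofReal_mul (Real.exp_pos _).le, ← mul_assoc, ← Real.exp_add]
  congr 3
  ring

omit [MetricSpace E] [MeasurableSpace S] in
lemma TendstoZeroEAS.ae_tendsto {V : ℕ → Ω → ℝ≥0∞} (h : TendstoZeroEAS P V) :
    ∀ᵐ ω ∂P, Tendsto (fun t : ℕ => V t ω) atTop (𝓝 0) := by
  obtain ⟨C, -, hC, h⟩ := h
  filter_upwards [h] with ω hω
  refine tendsto_of_tendsto_of_tendsto_of_le_of_le tendsto_const_nhds hω (fun _ => zero_le)
    fun t => ?_
  refine le_mul_of_one_le_left zero_le ?_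
  rw [ENNReal.one_le_ofReal]
  exact Real.one_le_exp (mul_nonneg (hC ω).le (Nat.cast_nonneg t))

/-- Continuous invertibility for random maps driven by an ergodic sequence. -/
theorem exists_continuouslyInvertible [IsProbabilityMeasure P] (hW : AEMeasurable W P)
    (hμ : ∀ k, MeasurePreserving (shift k) (P.map W) (P.map W))
    (herg : ∀ k : ℤ, k = 1 ∨ k = -1 → Ergodic (shift k) (P.map W))
    (hφ : ∀ θ, Measurable fun p : S × ℝ => φ p.1 p.2 θ)
    (hK : IsClosed K) (hΘ : IsCompact Θ) (hreg : IsRegular P K Θ fun t ω => φ (W ω t))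
    (hCI : CI P K Θ fun t ω => φ (W ω t)) :
    ∃ g : ℤ → Ω → C(Θ, K),
      IsStationarySolution P (fun t ω => φ (W ω t)) g ∧
      IsUniqueAtEachPoint P (fun t ω => φ (W ω t)) g ∧
      ContinuouslyInvertible P (fun t ω => φ (W ω t)) g ∧
      ∀ g₀ : Ω → C(Θ, K), TendstoZeroEAS P (approxError (fun t ω => φ (W ω t)) g g₀) := by
  classical
  have : CompactSpace Θ := isCompact_iff_compactSpace.1 hΘ
  obtain ⟨ρ, hρ, hc⟩ := exists_ae_isContracting hW hμ herg hφ hK hΘ hreg hCI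
  obtain ⟨L, hL, -⟩ := hCI.lipMoment
  have hf := hreg.ae_isContinuousFamily hΘ hL
  obtain ⟨y, hy, hyfin⟩ := hCI.moment
  have hgrow := ae_exists_abs_le_exp hW hμ herg hφ hΘ hreg hy hyfin (half_pos hρ)
  -- The constant `y` is a default value on the null event where the limit may fail to exist.
  let g : ℤ → Ω → C(Θ, K) := fun t ω =>
    if h : ∃ G : C(Θ, K), ∀ θ : Θ,
      Tendsto (fun n : ℕ => iter (fun u => φ (W ω u)) n (t - 1) y θ) atTop (𝓝 (G θ))
    then h.choose else ContinuousMap.const Θ ⟨y, hy⟩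
  have hg : ∀ᵐ ω ∂P, ∀ (t : ℤ) (θ : Θ), Tendsto
      (fun n : ℕ => iter (fun u => φ (W ω u)) n (t - 1) y θ) atTop (𝓝 (g t ω θ)) := by
    filter_upwards [hc, hf, hgrow] with ω h1 h2 h3 t
    have h := exists_tendsto_iter h2 hK hΘ hρ h1 hy t (h3 t)
    simp only [g, dif_pos h]
    exact h.choose_spec
  have hsol : IsStationarySolution P (fun t ω => φ (W ω t)) g := by
    refine ⟨isStationary_of_tendsto_iter hW hμ hφ hK hΘ ⟨ContinuousMap.const Θ ⟨y, hy⟩⟩ hg, ?_⟩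
    filter_upwards [hf, hg] with ω h1 h2 t θ
    have h3 := h2 (t + 1) θ
    rw [add_sub_cancel_right] at h3
    exact eq_of_tendsto_iter h1 hy (g t ω θ).2 θ.2 (h2 t θ) h3
  exact ⟨g, hsol, isUniqueAtEachPoint_of_isContracting hρ hc hsol,
    fun g₀ => (tendstoZeroEAS_approxError hρ hc hsol g₀).ae_tendsto,
    tendstoZeroEAS_approxError hρ hc hsol⟩

end Final

end VolModel

theorem theorem3p2 {Ω E : Type*} [MeasurableSpace Ω] [MetricSpace E]
    (P : Measure Ω) [IsProbabilityMeasure P]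
    (M : VolModel.Model E) (θ₀ : E) (Z v : ℤ → Ω → ℝ)
    (hZ : VolModel.IsInnovation P Z) (hST : M.ST θ₀ P Z v)
    (Θ : Set E) (hΘ : IsCompact Θ)
    (K : Set ℝ) (hK : IsClosed K) (hKdom : K ⊆ M.h '' M.dom)
    (hreg : VolModel.IsRegular P K Θ (M.obsMap Z v))
    (hCI : VolModel.CI P K Θ (M.obsMap Z v)) :
    ∃ g : ℤ → Ω → C(Θ, K),
      VolModel.IsStationarySolution P (M.obsMap Z v) g ∧
      VolModel.IsUniqueAtEachPoint P (M.obsMap Z v) g ∧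
      VolModel.ContinuouslyInvertible P (M.obsMap Z v) g ∧
      ∀ g₀ : Ω → C(Θ, K),
        VolModel.TendstoZeroEAS P (VolModel.approxError (M.obsMap Z v) g g₀) := by
  have hW := hST.solution.aemeasurable_path hZ
  have : IsProbabilityMeasure (P.map (VolModel.path Z v)) := Measure.isProbabilityMeasure_map hW
  -- The observation `X_t = σ_t Z_t` is a function of the pair `s = (σ_t², Z_t)`, so the ergodic
  -- path of pairs drives the random maps.
  refine VolModel.exists_continuouslyInvertible (W := VolModel.path Z v)
    (φ := fun s x θ => M.φ (√s.1 * s.2) x θ) hW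
    (hST.solution.isSolutionLaw_map hZ).measurePreserving_shift
    (fun k => hST.ergodic_shift hZ) (fun θ => ?_) hK hΘ hreg hCI
  have hs : Measurable fun p : (ℝ × ℝ) × ℝ => √p.1.1 * p.1.2 / √(M.link p.2) :=
    ((Real.continuous_sqrt.measurable.comp (measurable_fst.comp measurable_fst)).mul
      (measurable_snd.comp measurable_fst)).div
      (Real.continuous_sqrt.measurable.comp (M.link_meas.comp measurable_snd))
  exact (M.ψ_meas θ).comp (hs.prodMk measurable_snd)
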